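/- Let $\mathbb F$ be an algebraically closed field, $n\ge 1$ and $d\ge 0$. For $m\ge 1$ let $\operatorname{Rep}(GL_m)$ be the category of rational representations of $GL_m=GL_m(\mathbb F)$, i.e. of finite-dimensional representations whose matrix coefficients are polynomials in the matrix entries and $\det^{-1}$, and let $\operatorname{Rep}^d(GL_m)$ be its full subcategory of polynomial representations of degree $d$: those $M$ all of whose weights $\mu\in\mathbb Z^m$ with respect to the torus of diagonal matrices satisfy $\mu_1,\dots,\mu_m\ge 0$ and $\mu_1+\dots+\mu_m=d$. For a dominant weight $\lambda=(\lambda_1\ge\dots\ge\lambda_m)\in\mathbb Z^m$ let $\Delta(\lambda)$ be the Weyl module, i.e. the universal rational representation with a vector $v_\lambda$ such that $b\,v_\lambda=\prod_i b_{ii}^{\lambda_i}\,v_\lambda$ for all upper triangular $b\in GL_m$ (for every $N\in\operatorname{Rep}(GL_m)$ and every $u\in N$ with $b\,u=\prod_i b_{ii}^{\lambda_i}\,u$ for all upper triangular $b$ there is a unique homomorphism $\Delta(\lambda)\to N$ with $v_\lambda\mapsto u$), and let $L(\lambda)=\Delta(\lambda)/R$, where $R$ is the sum of all submodules of $\Delta(\lambda)$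 not containing $v_\lambda$. Let $S=\{\operatorname{diag}(1,\dots,1,t) : t\in\mathbb F^\times\}\subset GL_{n+1}$. If $M\in\operatorname{Rep}^d(GL_{n+1})$, then the space $M^S$ of $S$-invariants, with the action of $GL_n$ embedded in the upper left corner of $GL_{n+1}$, lies in $\operatorname{Rep}^d(GL_n)$, so that there is a functor $$\tau_n^{n+1}:\operatorname{Rep}^d(GL_{n+1})\to\operatorname{Rep}^d(GL_n),\qquad M\mapsto M^S .$$ Then: 1. $\tau_n^{n+1}$ is exact. 2. For every $\lambda=(\lambda_1\ge\dots\ge\lambda_n\ge 0)\in\mathbb Z^n$ with $\lambda_1+\dots+\lambda_n=d$, the modules $\Delta(\lambda,0)$ and $L(\lambda,0)$ lie in $\operatorname{Rep}^d(GL_{n+1})$, the modules $\Delta(\lambda)$ and $L(\lambda)$ lie in $\operatorname{Rep}^d(GL_n)$, and $\tau_n^{n+1}(\Delta(\lambda,0))\cong\Delta(\lambda)$ and $\tau_n^{n+1}(L(\lambda,0))\cong L(\lambda)$. 3. If $n\ge d$, then $\tau_n^{n+1}$ is an equivalence of categories. Consequently the stable category $\operatorname{Rep}^d(GL):=\operatorname{Rep}^d(GL_{\max(1,d)})$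 is equivalent to $\operatorname{Rep}^d(GL_m)$ for every $m\ge\max(1,d)$, through the composite $\tau_{\max(1,d)}^{\max(1,d)+1}\circ\dots\circ\tau_{m-1}^{m}:\operatorname{Rep}^d(GL_m)\to\operatorname{Rep}^d(GL)$. -/

import Mathlib

open CategoryTheory CategoryTheory.Limits
open scoped MonoidAlgebra

universe u

noncomputable section

namespace PolyGL

variable {F : Type u} [Field F] {n : ℕ}

/-- The diagonal matrix `diag(t₁, …, tₙ)`, an element of the maximal torus `T ⊆ GL_n`. -/
def diag (t : Fin n → Fˣ) : GL (Fin n) F where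
  val := Matrix.diagonal fun i => (t i : F)
  inv := Matrix.diagonal fun i => ((t i)⁻¹ : Fˣ)
  val_inv := by simp [Matrix.diagonal_mul_diagonal]
  inv_val := by simp [Matrix.diagonal_mul_diagonal]

/-- The element `diag(1, …, 1, s)` of the one-dimensional subtorus `S ⊆ GL_{n+1}`. -/
def subtorus (s : Fˣ) : GL (Fin (n + 1)) F :=
  diag (Fin.snoc (fun _ => (1 : Fˣ)) s : Fin (n + 1) → Fˣ)

/-- The block matrix with diagonal blocks `A` and `1`. -/
def blockHom : Matrix (Fin n) (Fin n) F →* Matrix (Fin (n + 1)) (Fin (n + 1)) F where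
  toFun A := Matrix.reindex finSumFinEquiv finSumFinEquiv
    (Matrix.fromBlocks A 0 0 (1 : Matrix (Fin 1) (Fin 1) F))
  map_one' := by simp
  map_mul' A B := by
    simp [Matrix.submatrix_mul_equiv, Matrix.fromBlocks_multiply]

/-- The standard embedding `GL_n → GL_{n+1}` into the upper left corner. -/
def embed : GL (Fin n) F →* GL (Fin (n + 1)) F := Units.map blockHom

/-- The character `b ↦ ∏ bᵢᵢ ^ λᵢ` of the group of upper triangular matrices (as a function on
all of `GL_n`; only its values at upper triangular matrices are used). -/
def borelChar (wt : Fin n → ℤ) (b : GL (Fin n) F) : F := ∏ i, b.val i i ^ wt i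

section Properties

variable {V : Type*} [AddCommGroup V] [Module F V]

/-- Rational representations of `GL_n`: finite dimensional, with all matrix coefficients
polynomials in the matrix entries and `det⁻¹`. -/
structure IsRational (ρ : Representation F (GL (Fin n) F) V) : Prop where
  finite : Module.Finite F V
  coeff : ∀ (φ : Module.Dual F V) (v : V),
    ∃ (P : MvPolynomial (Fin n × Fin n) F) (k : ℕ), ∀ g : GL (Fin n) F,
      φ (ρ g v) = MvPolynomial.eval (fun ij => g.val ij.1 ij.2) P * (g.val.det ^ k)⁻¹

/-- The weight space `V_μ` for the torus of diagonal matrices. -/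
def weightSpace (ρ : Representation F (GL (Fin n) F) V) (μ : Fin n → ℤ) : Submodule F V where
  carrier := {v | ∀ t : Fin n → Fˣ, ρ (diag t) v = (∏ i, (t i : F) ^ μ i) • v}
  add_mem' ha hb t := by simp [ha t, hb t]
  zero_mem' t := by simp
  smul_mem' c v hv t := by simp [hv t, smul_comm c]

/-- Polynomial representations of degree `d`: rational representations all of whose weights
`μ` satisfy `μ₁, …, μₙ ≥ 0` and `μ₁ + ⋯ + μₙ = d`. -/
structure IsPolynomial (d : ℕ) (ρ : Representation F (GL (Fin n) F) V) : Prop where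
  rational : IsRational ρ
  weights : ∀ μ : Fin n → ℤ, weightSpace ρ μ ≠ ⊥ → (∀ i, 0 ≤ μ i) ∧ ∑ i, μ i = d

/-- The subspace `V^S` of `S`-invariants in a representation of `GL_{n+1}`. -/
def invariants (ρ : Representation F (GL (Fin (n + 1)) F) V) : Submodule F V where
  carrier := {v | ∀ s : Fˣ, ρ (subtorus s) v = v}
  add_mem' ha hb s := by simp [ha s, hb s]
  zero_mem' s := by simp
  smul_mem' c v hv s := by simp [hv s]

end Properties

/-! ### The categories of polynomial representations -/

section Categories

variable (F n)

/-- The property of being a polynomial representation of degree `d`. -/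
def polProp (d : ℕ) : ObjectProperty (Rep.{u} F (GL (Fin n) F)) :=
  fun M => IsPolynomial d M.ρ

/-- `Rep^d(GL_n)`, a full subcategory of the category of representations of `GL_n`. -/
abbrev PolRep (d : ℕ) := (polProp F n d).FullSubcategory

end Categories

/-! ### Weyl modules and irreducible modules -/

/-- The left ideal of `F[GL_n]` defining the Weyl module `Δ(λ)`: the intersection of all left
ideals `J` that contain `b - λ(b)` for every upper triangular `b` and whose quotient `F[GL_n]/J`
is a rational representation. Modulo it, `1` is the universal vector on which the upper triangular
matrices act through `λ` (see `weyl_universal`). -/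
def weylIdeal (wt : Fin n → ℤ) :
    Submodule (F[GL (Fin n) F]) (F[GL (Fin n) F]) :=
  sInf {J | (∀ b : GL (Fin n) F, b.val.BlockTriangular id →
      MonoidAlgebra.single b (1 : F) - MonoidAlgebra.single 1 (borelChar wt b) ∈ J) ∧
    IsRational (Representation.ofModule' (k := F) (G := GL (Fin n) F) (F[GL (Fin n) F] ⧸ J))}

/-- The Weyl module `Δ(λ)` as a module over the group algebra. -/
abbrev WeylMod (F : Type u) [Field F] {n : ℕ} (wt : Fin n → ℤ) : Type u :=
  (F[GL (Fin n) F]) ⧸ (weylIdeal (F := F) wt)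

/-- The generator (highest weight vector) `v_λ` of `Δ(λ)`. -/
def weylVec (wt : Fin n → ℤ) : WeylMod F wt := Submodule.Quotient.mk 1

/-- The sum `R` of all submodules of `Δ(λ)` not containing `v_λ`. -/
def weylRad (wt : Fin n → ℤ) : Submodule (F[GL (Fin n) F]) (WeylMod F wt) :=
  sSup {N | weylVec wt ∉ N}

variable (F) in
/-- The Weyl module `Δ(λ)`: the universal representation of `GL_n` generated by a vector on which
the upper triangular matrices act through `λ`. -/
abbrev weyl (wt : Fin n → ℤ) : Rep.{u} F (GL (Fin n) F) :=
  Rep.of (Representation.ofModule' (k := F) (G := GL (Fin n) F) (WeylMod F wt))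

variable (F) in
/-- The irreducible module `L(λ) = Δ(λ)/R`. -/
abbrev irr (wt : Fin n → ℤ) : Rep.{u} F (GL (Fin n) F) :=
  Rep.of (Representation.ofModule' (k := F) (G := GL (Fin n) F)
    (WeylMod F wt ⧸ weylRad (F := F) wt))

/-- Subrepresentations of rational representations, in the form of injective intertwining maps,
are rational. -/
lemma IsRational.of_injective {V W : Type*} [AddCommGroup V] [Module F V] [AddCommGroup W]
    [Module F W] {ρ : Representation F (GL (Fin n) F) V} {σ : Representation F (GL (Fin n) F) W}
    (hσ : IsRational σ) (f : V →ₗ[F] W) (hf : Function.Injective f)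
    (hfρ : ∀ g v, f (ρ g v) = σ g (f v)) : IsRational ρ := by
  have := hσ.finite
  refine ⟨Module.Finite.of_injective f hf, fun φ v => ?_⟩
  obtain ⟨r, hr⟩ := f.exists_leftInverse_of_injective (LinearMap.ker_eq_bot.2 hf)
  obtain ⟨P, k, hP⟩ := hσ.coeff (φ ∘ₗ r) (f v)
  refine ⟨P, k, fun g => ?_⟩
  rw [← hP g, ← hfρ]
  have h := LinearMap.congr_fun hr (ρ g v)
  simp only [LinearMap.comp_apply, LinearMap.id_apply] at h
  simp [h]

/-- The universal property that characterizes `Δ(λ)`: a vector `m` of a rational representation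
with `b m = λ(b) m` for all upper triangular `b` is the image of `v_λ` under a unique
homomorphism. -/
lemma weyl_universal (wt : Fin n → ℤ) (M : Rep.{u} F (GL (Fin n) F)) (hM : IsRational M.ρ)
    (m : M.V) (hm : ∀ b : GL (Fin n) F, b.val.BlockTriangular id → M.ρ b m = borelChar wt b • m) :
    ∃! f : weyl F wt ⟶ M, f.hom (weylVec (F := F) wt) = m := by
  let e : F[GL (Fin n) F] →ₗ[F[GL (Fin n) F]] M.ρ.asModule :=
    LinearMap.toSpanSingleton _ _ (M.ρ.asModuleEquiv.symm m)
  have he : ∀ x, M.ρ.asModuleEquiv (e x) = M.ρ.asAlgebraHom x m := fun x => by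
    simp [e, Representation.asModuleEquiv_map_smul]
  have hle : weylIdeal (F := F) wt ≤ LinearMap.ker e := by
    refine sInf_le ⟨fun b hb => ?_, ?_⟩
    · rw [LinearMap.mem_ker]
      apply M.ρ.asModuleEquiv.injective
      rw [he]
      simp [Representation.asAlgebraHom_single, hm b hb]
    · refine hM.of_injective
        (M.ρ.asModuleEquiv.toLinearMap ∘ₗ
          ((LinearMap.ker e).liftQ e le_rfl).restrictScalars F) ?_ ?_
      · refine M.ρ.asModuleEquiv.injective.comp ?_
        exact LinearMap.ker_eq_bot.1 (Submodule.ker_liftQ_eq_bot _ e le_rfl le_rfl)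
      · intro g v
        obtain ⟨x, rfl⟩ := Submodule.Quotient.mk_surjective _ v
        change M.ρ.asModuleEquiv (e (MonoidAlgebra.single g 1 • x)) =
          M.ρ g (M.ρ.asModuleEquiv (e x))
        rw [he, he, smul_eq_mul, map_mul]
        simp [Representation.asAlgebraHom_single]
  refine ⟨Rep.ofHom
    { toLinearMap := M.ρ.asModuleEquiv.toLinearMap ∘ₗ
        ((weylIdeal (F := F) wt).liftQ e hle).restrictScalars F
      isIntertwining' := ?_ }, ?_, ?_⟩
  · intro g
    refine LinearMap.ext fun v => ?_
    obtain ⟨x, rfl⟩ := Submodule.Quotient.mk_surjective _ v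
    change M.ρ.asModuleEquiv (e (MonoidAlgebra.single g 1 • x)) =
      M.ρ g (M.ρ.asModuleEquiv (e x))
    rw [he, he, smul_eq_mul, map_mul]
    simp [Representation.asAlgebraHom_single]
  · change M.ρ.asModuleEquiv (e 1) = m
    rw [he]; simp
  · intro f hf
    have key : ∀ q : WeylMod F wt →ₗ[F] M.V,
        (∀ g x, q (MonoidAlgebra.single g (1 : F) • x) = M.ρ g (q x)) → q (weylVec wt) = m →
        ∀ x, q ((weylIdeal wt).mkQ x) = M.ρ.asAlgebraHom x m := by
      intro q hq hqm x
      induction x using MonoidAlgebra.induction_linear with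
      | zero => simp
      | add x y hx hy => rw [map_add, map_add, map_add, LinearMap.add_apply, hx, hy]
      | single g a =>
        have h1 : (weylIdeal (F := F) wt).mkQ (MonoidAlgebra.single g a) =
            a • (MonoidAlgebra.single g (1 : F) • weylVec wt) := by
          change _ = a • (weylIdeal (F := F) wt).mkQ (MonoidAlgebra.single g 1 • 1)
          rw [← LinearMap.map_smul_of_tower]; simp
        rw [h1, map_smul, hq, hqm]
        simp [Representation.asAlgebraHom_single]
    apply Rep.hom_ext
    apply Representation.IntertwiningMap.ext
    refine LinearMap.ext fun v => ?_
    obtain ⟨x, rfl⟩ := Submodule.Quotient.mk_surjective _ v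
    exact (key f.hom.toLinearMap (fun g x => Rep.hom_comm_apply f g x) hf x).trans (he x).symm

/-! ### The functor of `S`-invariants -/

lemma embed_last_last (g : GL (Fin n) F) :
    (embed g).val (Fin.last n) (Fin.last n) = 1 := by
  have h : (Fin.last n) = finSumFinEquiv (Sum.inr (0 : Fin 1)) := by
    ext; simp
  rw [h]; simp [embed, blockHom]

lemma embed_castSucc (g : GL (Fin n) F) (i j : Fin n) :
    (embed g).val i.castSucc j.castSucc = g.val i j := by
  have h : ∀ i : Fin n, i.castSucc = finSumFinEquiv (Sum.inl i : Fin n ⊕ Fin 1) := by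
    intro i; ext; simp
  rw [h, h]; simp [embed, blockHom]

lemma embed_castSucc_last (g : GL (Fin n) F) (i : Fin n) :
    (embed g).val i.castSucc (Fin.last n) = 0 := by
  have h : ∀ i : Fin n, i.castSucc = finSumFinEquiv (Sum.inl i : Fin n ⊕ Fin 1) := by
    intro i; ext; simp
  have h' : (Fin.last n) = finSumFinEquiv (Sum.inr (0 : Fin 1)) := by
    ext; simp
  rw [h, h']; simp [embed, blockHom]

lemma embed_last_castSucc (g : GL (Fin n) F) (i : Fin n) :
    (embed g).val (Fin.last n) i.castSucc = 0 := by
  have h : ∀ i : Fin n, i.castSucc = finSumFinEquiv (Sum.inl i : Fin n ⊕ Fin 1) := by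
    intro i; ext; simp
  have h' : (Fin.last n) = finSumFinEquiv (Sum.inr (0 : Fin 1)) := by
    ext; simp
  rw [h, h']; simp [embed, blockHom]

lemma embed_det (g : GL (Fin n) F) : (embed g).val.det = g.val.det := by
  simp [embed, blockHom]

lemma subtorus_comm (g : GL (Fin n) F) (s : Fˣ) :
    subtorus s * embed g = embed g * subtorus s := by
  apply Units.ext
  ext i j
  simp only [subtorus, diag, Units.val_mul, Matrix.diagonal_mul, Matrix.mul_diagonal]
  refine Fin.lastCases ?_ (fun i => ?_) i <;> refine Fin.lastCases ?_ (fun j => ?_) j <;>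
    simp [embed_castSucc_last, embed_last_castSucc, mul_comm]

lemma diag_snoc (t : Fin n → Fˣ) (s : Fˣ) :
    diag (Fin.snoc t s : Fin (n + 1) → Fˣ) = embed (diag t) * subtorus s := by
  apply Units.ext
  ext i j
  simp only [subtorus, Units.val_mul]
  simp only [diag, Matrix.mul_diagonal]
  change _ = (embed (diag t)).val i j * _
  refine Fin.lastCases ?_ (fun i => ?_) i <;> refine Fin.lastCases ?_ (fun j => ?_) j
  · simp [embed_last_last]
  · simp [embed_last_castSucc, Matrix.diagonal_apply, Fin.ext_iff]; omega
  · simp [embed_castSucc_last, Matrix.diagonal_apply, Fin.ext_iff]; omega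
  · simp [embed_castSucc, diag, Matrix.diagonal_apply]

section Inv

variable {V : Type*} [AddCommGroup V] [Module F V]

/-- The representation of `GL_n` on `V^S`. -/
def invRep (ρ : Representation F (GL (Fin (n + 1)) F) V) :
    Representation F (GL (Fin n) F) (invariants ρ) where
  toFun g := (ρ (embed g)).restrict (p := invariants ρ) (q := invariants ρ) (by
    intro v hv s
    have h : ρ (subtorus s * embed g) v = ρ (embed g * subtorus s) v := by rw [subtorus_comm]
    simpa [hv s] using h)
  map_one' := by ext; simp
  map_mul' x y := by
    ext v
    change ρ (embed (x * y)) v.1 = ρ (embed x) (ρ (embed y) v.1)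
    simp

@[simp]
lemma invRep_coe (ρ : Representation F (GL (Fin (n + 1)) F) V) (g : GL (Fin n) F)
    (v : invariants ρ) : ((invRep ρ g v : invariants ρ) : V) = ρ (embed g) v := rfl

lemma invRep_isPolynomial {d : ℕ} {ρ : Representation F (GL (Fin (n + 1)) F) V}
    (h : IsPolynomial d ρ) : IsPolynomial d (invRep ρ) := by
  have := h.rational.finite
  refine ⟨⟨inferInstance, fun φ v => ?_⟩, fun μ hμ => ?_⟩
  · obtain ⟨ψ, hψ⟩ := LinearMap.exists_extend φ
    obtain ⟨P, k, hP⟩ := h.rational.coeff ψ v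
    let f : Fin (n + 1) × Fin (n + 1) → MvPolynomial (Fin n × Fin n) F := fun ij =>
      Fin.lastCases (motive := fun _ => MvPolynomial (Fin n × Fin n) F)
        (Fin.lastCases (motive := fun _ => MvPolynomial (Fin n × Fin n) F) 1 (fun _ => 0) ij.2)
        (fun i => Fin.lastCases (motive := fun _ => MvPolynomial (Fin n × Fin n) F)
          0 (fun j => MvPolynomial.X (i, j)) ij.2) ij.1
    refine ⟨MvPolynomial.bind₁ f P, k, fun g => ?_⟩
    have h1 : φ (invRep ρ g v) = ψ (ρ (embed g) v) := by
      rw [← hψ]; rfl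
    rw [h1, hP, embed_det]
    congr 1
    have hb : MvPolynomial.eval (fun ij => g.val ij.1 ij.2) (MvPolynomial.bind₁ f P) =
        MvPolynomial.eval
          (fun ij => MvPolynomial.eval (fun ij => g.val ij.1 ij.2) (f ij)) P :=
      MvPolynomial.eval₂Hom_bind₁ (RingHom.id F) _ f P
    rw [hb]
    congr 2
    funext ⟨i, j⟩
    refine Fin.lastCases ?_ (fun i => ?_) i <;> refine Fin.lastCases ?_ (fun j => ?_) j <;>
      simp [f, embed_castSucc, embed_castSucc_last, embed_last_castSucc, embed_last_last]
  · obtain ⟨v, hv, hv0⟩ := (Submodule.ne_bot_iff _).1 hμ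
    have key : weightSpace ρ (Fin.snoc μ 0 : Fin (n + 1) → ℤ) ≠ ⊥ := by
      refine (Submodule.ne_bot_iff _).2 ⟨v, fun t => ?_, by simpa using hv0⟩
      have ht : t = Fin.snoc (Fin.init t) (t (Fin.last n)) := (Fin.snoc_init_self t).symm
      have h2 := congrArg Subtype.val (hv (Fin.init t))
      simp only [invRep_coe, Submodule.coe_smul] at h2
      have h3 : ρ (subtorus (t (Fin.last n))) v = v := v.2 _
      rw [Fin.prod_univ_castSucc]
      conv_lhs => rw [ht, diag_snoc, map_mul]
      simp [h3, h2, Fin.init]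
    obtain ⟨h1, h2⟩ := h.weights _ key
    refine ⟨fun i => by simpa using h1 i.castSucc, ?_⟩
    rw [Fin.sum_univ_castSucc] at h2
    simpa using h2

end Inv

variable (F n)

/-- The functor `M ↦ M^S` from representations of `GL_{n+1}` to representations of `GL_n`. -/
def invFunctor : Rep.{u} F (GL (Fin (n + 1)) F) ⥤ Rep.{u} F (GL (Fin n) F) where
  obj M := Rep.of (invRep M.ρ)
  map {M N} f := Rep.ofHom
    { toLinearMap := f.hom.toLinearMap.restrict (p := invariants M.ρ) (q := invariants N.ρ) (by
        intro v hv s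
        have h := Rep.hom_comm_apply f (subtorus s) v
        rw [hv s] at h
        exact h.symm)
      isIntertwining' := by
        intro g
        ext v
        exact Rep.hom_comm_apply f (embed g) v.1 }
  map_id M := by ext; rfl
  map_comp f g := by ext; rfl

/-- The functor `τ_n^{n+1} : Rep^d(GL_{n+1}) ⥤ Rep^d(GL_n)`, `M ↦ M^S`. -/
def tau (d : ℕ) : PolRep F (n + 1) d ⥤ PolRep F n d :=
  (polProp F n d).lift ((polProp F (n + 1) d).ι ⋙ invFunctor F n)
    fun M => invRep_isPolynomial M.property

/-- The composition `Rep^d(GL_{n+k}) ⥤ ⋯ ⥤ Rep^d(GL_{n+1}) ⥤ Rep^d(GL_n)` of the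
functors `τ`. -/
def tauIter (d : ℕ) : (k : ℕ) → PolRep F (n + k) d ⥤ PolRep F n d
  | 0 => 𝟭 _
  | k + 1 => tau F (n + k) d ⋙ tauIter d k

/-- The stable category `Rep^d(GL)`, realized as `Rep^d(GL_n)` for the least positive `n`
with `n ≥ d`. -/
abbrev StableRep (d : ℕ) := PolRep F (max 1 d) d

end PolyGL

end

/-!
A representation of `GL_n` is polynomial of degree `d` if and only if its matrix coefficients are
homogeneous polynomials of degree `d` in the matrix entries: along the torus this is the condition
on the weights, and a denominator `det ^ k` must cancel because a matrix of the form
`g * diag t * g'` may degenerate to any singular matrix. Over an infinite field the action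
therefore extends to the monoid of all matrices, and `M^S` is the image of the idempotent
`diag(1, …, 1, 0)`. Hence `τ` is, on underlying vector spaces, a direct summand of the identity,
so that it preserves finite limits. It also has a right adjoint, which sends `V` to the space of
homogeneous polynomial maps `f` from `n × (n + 1)` matrices to `V` with `f (a * x) = a • f x`, and
whose counit `f ↦ f (1 | 0)` is an isomorphism.

For nonnegative `λ` the denominators `det ^ k` also cancel in the matrix coefficients of a highest
weight vector: a singular matrix times a suitable upper triangular one has a zero column, which
the torus rescales by arbitrary powers. As `Δ(λ)` is generated by such a vector, it is polynomial.
Via the adjunction, the universal properties of `Δ(λ)` and `Δ(λ,0)` give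
`τ Δ(λ,0) ≅ Δ(λ)`. Taking `S`-invariants of submodules of `Δ(λ,0)` is a left adjoint with a
section, hence maps the sum of the submodules that avoid `v_(λ,0)` to the sum of the submodules
that avoid `v_λ`; this is the statement on irreducible modules.

If `d ≤ n`, every weight of a polynomial representation of `GL_{n+1}` of degree `d` has a vanishing
entry. A permutation matrix moves it to the last place, so that a subrepresentation which contains
`M^S` is everything, and one which meets it trivially is zero. Thus `τ` reflects isomorphisms,
and as the counit of the adjunction is an isomorphism, so is the unit.
-/

noncomputable section

namespace PolyGL

/-! ### Polynomial functions on matrices -/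

section Divisibility

open MvPolynomial Matrix

variable {F : Type*} [Field F]

lemma mem_supported_of_dvd {σ : Type*} {s : Set σ} {P Q : MvPolynomial σ F} (hPQ : P ∣ Q)
    (hQ : Q ≠ 0) (hs : Q ∈ supported F s) : P ∈ supported F s := by
  classical
  obtain ⟨R, rfl⟩ := hPQ
  obtain ⟨hP, hR⟩ := mul_ne_zero_iff.1 hQ
  refine mem_supported.2 fun i hi => mem_supported.1 hs ?_
  simp only [Finset.mem_coe, vars_def, degrees_mul_eq hP hR, Multiset.toFinset_add,
    Finset.mem_union] at hi ⊢
  exact Or.inl hi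

variable (F) in
/-- The minor of the generic `(n + 1) × (n + 1)` matrix complementary to the entry `(0, j)`. -/
def genericMinor {n : ℕ} (j : Fin (n + 1)) : MvPolynomial (Fin (n + 1) × Fin (n + 1)) F :=
  ((mvPolynomialX _ _ F).submatrix Fin.succ j.succAbove).det

section GenericMinor

variable {n : ℕ} (j : Fin (n + 1))

lemma genericMinor_eq_rename :
    genericMinor F j = rename (Prod.map Fin.succ j.succAbove) (mvPolynomialX _ _ F).det := by
  rw [genericMinor, AlgHom.map_det]
  congr 1
  ext : 2
  simp

lemma genericMinor_ne_zero : genericMinor F j ≠ 0 := by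
  rw [genericMinor_eq_rename, (map_ne_zero_iff _ (rename_injective _
    ((Fin.succ_injective n).prodMap Fin.succAbove_right_injective)))]
  exact det_mvPolynomialX_ne_zero (Fin n) F

lemma genericMinor_mem_supported :
    genericMinor F j ∈ supported F {p : Fin (n + 1) × Fin (n + 1) | p.1 ≠ 0 ∧ p.2 ≠ j} := by
  classical
  rw [genericMinor_eq_rename, mem_supported]
  intro p hp
  obtain ⟨q, -, rfl⟩ := Finset.mem_image.1 (vars_rename _ _ hp)
  exact ⟨Fin.succ_ne_zero q.1, Fin.succAbove_ne j q.2⟩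

lemma det_mvPolynomialX_eq_sum : (mvPolynomialX (Fin (n + 1)) (Fin (n + 1)) F).det =
    ∑ j : Fin (n + 1), (-1) ^ (j : ℕ) * X (0, j) * genericMinor F j :=
  Matrix.det_succ_row_zero _

lemma pderiv_det_mvPolynomialX :
    pderiv (0, j) (mvPolynomialX (Fin (n + 1)) (Fin (n + 1)) F).det =
      (-1) ^ (j : ℕ) * genericMinor F j := by
  have hminor (k : Fin (n + 1)) : pderiv (0, j) (genericMinor F k) = 0 :=
    pderiv_eq_zero_of_notMem_vars fun h => (mem_supported.1 (genericMinor_mem_supported k) h).1 rfl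
  have hsign (k : ℕ) : pderiv (0, j) ((-1 : MvPolynomial (Fin (n + 1) × Fin (n + 1)) F) ^ k) = 0 :=
    by rw [← C_1, ← C_neg, ← C_pow, pderiv_C]
  rw [det_mvPolynomialX_eq_sum, map_sum, Finset.sum_eq_single j]
  · simp [hminor, hsign, mul_comm]
  · intro k _ hk
    have hX : pderiv (0, j) (X (0, k) : MvPolynomial (Fin (n + 1) × Fin (n + 1)) F) = 0 :=
      pderiv_X_of_ne fun h => hk (Prod.ext_iff.1 h).2
    simp [hminor, hsign, hX]
  · simp

lemma isRelPrime_det_genericMinor :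
    IsRelPrime (mvPolynomialX (Fin (n + 1)) (Fin (n + 1)) F).det (genericMinor F 0) := by
  intro Q hdet hminor
  have hrow := mem_supported_of_dvd hminor (genericMinor_ne_zero 0) (genericMinor_mem_supported 0)
  have hcol (j : Fin (n + 1)) : Q ∣ genericMinor F j := by
    obtain ⟨R, hR⟩ := hdet
    have hQ : pderiv (0, j) Q = 0 :=
      pderiv_eq_zero_of_notMem_vars fun h => (mem_supported.1 hrow h).1 rfl
    have h := pderiv_det_mvPolynomialX (F := F) j
    rw [hR, pderiv_mul, hQ, zero_mul, zero_add] at h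
    exact ((isUnit_one.neg.pow (j : ℕ)).dvd_mul_left).1 ⟨_, h.symm⟩
  have hvars : Q.vars = ∅ := Finset.eq_empty_of_forall_notMem fun p hp =>
    (mem_supported.1 (mem_supported_of_dvd (hcol p.2) (genericMinor_ne_zero _)
      (genericMinor_mem_supported _)) hp).2 rfl
  rw [vars_eq_empty_iff_eq_C] at hvars
  rw [hvars]
  refine (isUnit_iff_ne_zero.2 fun h0 => genericMinor_ne_zero (F := F) (0 : Fin (n + 1)) ?_).map C
  rwa [hvars, h0, C_0, zero_dvd_iff] at hminor

end GenericMinor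

section LinearInOneVariable

variable {σ : Type*} {i : σ} {M N : MvPolynomial σ F}

lemma exists_pow_mul_eq_mul_add (hM : M ∈ supported F {i}ᶜ) (hN : N ∈ supported F {i}ᶜ)
    (P : MvPolynomial σ F) :
    ∃ (k : ℕ) (Q R : MvPolynomial σ F), R ∈ supported F {i}ᶜ ∧
      M ^ k * P = (M * X i + N) * Q + R := by
  induction P using MvPolynomial.induction_on with
  | C a => exact ⟨0, 0, C a, Subalgebra.algebraMap_mem _ a, by simp⟩
  | add P₁ P₂ h₁ h₂ =>
    obtain ⟨k₁, Q₁, R₁, hR₁, h₁⟩ := h₁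
    obtain ⟨k₂, Q₂, R₂, hR₂, h₂⟩ := h₂
    refine ⟨k₁ + k₂, M ^ k₂ * Q₁ + M ^ k₁ * Q₂, M ^ k₂ * R₁ + M ^ k₁ * R₂,
      add_mem (mul_mem (pow_mem hM _) hR₁) (mul_mem (pow_mem hM _) hR₂), ?_⟩
    linear_combination M ^ k₂ * h₁ + M ^ k₁ * h₂
  | mul_X P j h =>
    obtain ⟨k, Q, R, hR, h⟩ := h
    by_cases hj : j = i
    · subst hj
      refine ⟨k + 1, M * Q * X j + R, -(R * N), neg_mem (mul_mem hR hN), ?_⟩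
      linear_combination M * X j * h
    · refine ⟨k, Q * X j, R * X j, mul_mem hR (Algebra.subset_adjoin ⟨j, hj, rfl⟩), ?_⟩
      linear_combination X j * h

lemma mul_X_add_dvd_of_forall_eval_eq_zero [Infinite F] (hM : M ∈ supported F {i}ᶜ)
    (hN : N ∈ supported F {i}ᶜ) (hM0 : M ≠ 0) (hrel : IsRelPrime (M * X i + N) M)
    {P : MvPolynomial σ F} (hP : ∀ x : σ → F, eval x (M * X i + N) = 0 → eval x P = 0) :
    M * X i + N ∣ P := by
  classical
  obtain ⟨k, Q, R, hR, h⟩ := exists_pow_mul_eq_mul_add hM hN P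
  suffices hR0 : R = 0 by
    exact hrel.pow_right.dvd_of_dvd_mul_left ⟨Q, by rw [h, hR0, add_zero]⟩
  refine (mul_eq_zero.1 (MvPolynomial.funext fun x => ?_ : R * M = 0)).resolve_right hM0
  by_cases hx : eval x M = 0
  · simp [hx]
  -- moving the `i`-th coordinate of `x` onto the hypersurface does not change `M`, `N` and `R`
  let y := Function.update x i (-eval x N / eval x M)
  have hy {S : MvPolynomial σ F} (hS : S ∈ supported F {i}ᶜ) : eval y S = eval x S :=
    eval₂Hom_congr' rfl (fun j hj _ => Function.update_of_ne (mem_supported.1 hS hj) _ _) rfl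
  have hD : eval y (M * X i + N) = 0 := by
    rw [map_add, map_mul, hy hM, hy hN, eval_X, show y i = _ from Function.update_self ..]
    field_simp
    ring
  have hRx := congrArg (eval y) h
  rw [map_add, map_mul, map_mul, hD, hP y hD, hy hR, mul_zero, zero_mul, zero_add] at hRx
  rw [map_mul, ← hRx, zero_mul, map_zero]

end LinearInOneVariable

theorem det_mvPolynomialX_dvd_of_forall_eval_eq_zero [Infinite F] {n : ℕ}
    {P : MvPolynomial (Fin n × Fin n) F}
    (hP : ∀ x : Matrix (Fin n) (Fin n) F, x.det = 0 → eval (fun ij => x ij.1 ij.2) P = 0) :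
    (mvPolynomialX (Fin n) (Fin n) F).det ∣ P := by
  obtain _ | n := n
  · rw [det_isEmpty]
    exact one_dvd P
  have hminor {j : Fin (n + 1)} :
      genericMinor F j ∈ supported F {((0 : Fin (n + 1)), (0 : Fin (n + 1)))}ᶜ :=
    supported_mono (fun p hp h => hp.1 (congrArg Prod.fst h)) (genericMinor_mem_supported j)
  have hdet : (mvPolynomialX (Fin (n + 1)) (Fin (n + 1)) F).det = genericMinor F 0 * X (0, 0) +
      ∑ j : Fin n, (-1) ^ (j.succ : ℕ) * X (0, j.succ) * genericMinor F j.succ := by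
    rw [det_mvPolynomialX_eq_sum, Fin.sum_univ_succ]
    simp [mul_comm]
  rw [hdet]
  refine mul_X_add_dvd_of_forall_eval_eq_zero hminor (sum_mem fun j _ => mul_mem (mul_mem
    (pow_mem (neg_mem (one_mem _)) _) (Algebra.subset_adjoin ⟨(0, j.succ), ?_, rfl⟩)) hminor)
    (genericMinor_ne_zero 0) (hdet ▸ isRelPrime_det_genericMinor) fun x hx => ?_
  · simp [Fin.succ_ne_zero]
  · rw [← hdet, eval_det_mvPolynomialX] at hx
    exact hP (of fun i j => x (i, j)) hx

end Divisibility

section PolynomialFunctions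

variable {F : Type*} [Field F] {E E' : Type*} [AddCommGroup E] [Module F E] [AddCommGroup E']
  [Module F E']

variable (F E) in
/-- The homogeneous polynomial functions of degree `d` on an `F`-module `E`, defined without
coordinates as the span of the products of `d` linear forms. -/
def homogeneousFun (d : ℕ) : Submodule F (E → F) :=
  LinearMap.range (LinearMap.ltoFun F E F F) ^ d

variable (F E) in
/-- The algebra of polynomial functions on an `F`-module `E`, generated by the linear forms. -/
def polynomialFun : Subalgebra F (E → F) :=
  Algebra.adjoin F (LinearMap.range (LinearMap.ltoFun F E F F))

lemma dual_mem_polynomialFun (φ : Module.Dual F E) : ⇑φ ∈ polynomialFun F E :=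
  Algebra.subset_adjoin ⟨φ, rfl⟩

lemma mem_polynomialFun_of_mem_homogeneousFun {d : ℕ} {f : E → F}
    (hf : f ∈ homogeneousFun F E d) : f ∈ polynomialFun F E := by
  induction hf using Submodule.pow_induction_on_left' with
  | algebraMap r => exact (polynomialFun F E).algebraMap_mem r
  | add _ _ _ _ _ hf hg => exact add_mem hf hg
  | mem_mul φ hφ _ _ _ hf =>
    exact (polynomialFun F E).mul_mem (Algebra.subset_adjoin hφ) hf

lemma prod_pow_mem_polynomialFun {ι : Type*} [Fintype ι] (m : ι → ℕ) :
    (fun t : ι → F => ∏ i, t i ^ m i) ∈ polynomialFun F (ι → F) := by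
  have h : (fun t : ι → F => ∏ i, t i ^ m i) =
      ∏ i, ⇑(LinearMap.proj (R := F) (φ := fun _ : ι => F) i) ^ m i := by
    funext t; simp
  rw [h]
  exact (polynomialFun F (ι → F)).prod_mem fun i _ =>
    (polynomialFun F (ι → F)).pow_mem (dual_mem_polynomialFun _) _

lemma comp_mem_of_forall_dual_comp_mem {X : Type*} {A : Subalgebra F (X → F)} {f : E → F}
    (hf : f ∈ polynomialFun F E) {L : X → E} (hL : ∀ φ : Module.Dual F E, φ ∘ L ∈ A) :
    f ∘ L ∈ A := by
  induction hf using Algebra.adjoin_induction with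
  | mem f hf => obtain ⟨φ, rfl⟩ := hf; exact hL φ
  | algebraMap r => exact A.algebraMap_mem r
  | add f g _ _ hf hg => exact add_mem hf hg
  | mul f g _ _ hf hg => exact mul_mem hf hg

lemma comp_mem_polynomialFun {f : E → F} (hf : f ∈ polynomialFun F E) (L : E' →ₗ[F] E) :
    f ∘ L ∈ polynomialFun F E' :=
  comp_mem_of_forall_dual_comp_mem hf fun φ => dual_mem_polynomialFun (φ ∘ₗ L)

lemma comp_mem_homogeneousFun {d : ℕ} {f : E → F} (hf : f ∈ homogeneousFun F E d)
    (L : E' →ₗ[F] E) : f ∘ L ∈ homogeneousFun F E' d := by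
  induction hf using Submodule.pow_induction_on_left' with
  | algebraMap r => rw [homogeneousFun, pow_zero]; exact Submodule.algebraMap_mem r
  | add _ _ _ _ _ hf hg => exact add_mem hf hg
  | mem_mul φ hφ i f _ hf =>
    obtain ⟨φ, rfl⟩ := hφ
    rw [homogeneousFun, pow_succ']
    exact Submodule.mul_mem_mul ⟨φ ∘ₗ L, rfl⟩ hf

lemma homogeneousFun_smul {d : ℕ} {f : E → F} (hf : f ∈ homogeneousFun F E d) (c : F) (x : E) :
    f (c • x) = c ^ d * f x := by
  induction hf using Submodule.pow_induction_on_left' with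
  | algebraMap r => simp
  | add f g _ _ _ hf hg => rw [Pi.add_apply, hf, hg, Pi.add_apply, mul_add]
  | mem_mul φ hφ i f _ hf =>
    obtain ⟨φ, rfl⟩ := hφ
    rw [Pi.mul_apply, hf, Pi.mul_apply, LinearMap.ltoFun_apply, map_smul, smul_eq_mul, pow_succ]
    ring

instance [Module.Finite F E] (d : ℕ) : Module.Finite F (homogeneousFun F E d) :=
  Module.Finite.iff_fg.2 ((Module.Finite.iff_fg.1 inferInstance).pow d)

lemma mem_polynomialFun_iff {ι : Type*} [Finite ι] (b : Module.Basis ι F E) {f : E → F} :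
    f ∈ polynomialFun F E ↔
      ∃ P : MvPolynomial ι F, ∀ x, f x = MvPolynomial.eval (b.repr x) P := by
  classical
  have := Fintype.ofFinite ι
  have hspan : LinearMap.range (LinearMap.ltoFun F E F F) =
      Submodule.span F (Set.range fun i => ⇑(b.coord i)) := by
    rw [LinearMap.range_eq_map, ← b.dualBasis.span_eq, Submodule.map_span, ← Set.range_comp]
    congr 2
    funext i
    simp
  rw [polynomialFun, hspan, Algebra.adjoin_span, Algebra.adjoin_range_eq_range_aeval]
  have heval (P : MvPolynomial ι F) (x : E) :
      MvPolynomial.aeval (fun i => ⇑(b.coord i)) P x = MvPolynomial.eval (b.repr x) P := by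
    induction P using MvPolynomial.induction_on with
    | C a => simp
    | add P Q hP hQ => simp [hP, hQ]
    | mul_X P i hP => simp [hP]
  simp only [AlgHom.mem_range, funext_iff, heval]
  exact exists_congr fun P => forall_congr' fun x => eq_comm

lemma mem_polynomialFun_matrix_iff {ι κ : Type*} [Finite ι] [Finite κ]
    {f : Matrix ι κ F → F} : f ∈ polynomialFun F (Matrix ι κ F) ↔
      ∃ P : MvPolynomial (ι × κ) F, ∀ x, f x = MvPolynomial.eval (fun ij => x ij.1 ij.2) P := by
  have := Fintype.ofFinite ι
  have := Fintype.ofFinite κ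
  exact mem_polynomialFun_iff (Matrix.stdBasis F ι κ)

lemma exists_polynomial_eval_eq {f : F → F} (hf : f ∈ polynomialFun F F) :
    ∃ q : Polynomial F, ∀ s, f s = q.eval s := by
  induction hf using Algebra.adjoin_induction with
  | mem f hf =>
    obtain ⟨φ, rfl⟩ := hf
    refine ⟨.C (φ 1) * .X, fun s => ?_⟩
    rw [Polynomial.eval_mul, Polynomial.eval_C, Polynomial.eval_X, LinearMap.ltoFun_apply, mul_comm,
      ← smul_eq_mul, ← map_smul, smul_eq_mul, mul_one]
  | algebraMap r => exact ⟨.C r, fun s => by simp⟩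
  | add f g _ _ hf hg =>
    obtain ⟨⟨p, hp⟩, q, hq⟩ := And.intro hf hg
    exact ⟨p + q, fun s => by simp [hp, hq]⟩
  | mul f g _ _ hf hg =>
    obtain ⟨⟨p, hp⟩, q, hq⟩ := And.intro hf hg
    exact ⟨p * q, fun s => by simp [hp, hq]⟩

lemma exists_polynomial_eval_add_smul {f : E → F} (hf : f ∈ polynomialFun F E) (a b : E) :
    ∃ q : Polynomial F, ∀ s : F, f (a + s • b) = q.eval s := by
  refine exists_polynomial_eval_eq
    (comp_mem_of_forall_dual_comp_mem hf (L := fun s => a + s • b) fun φ => ?_)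
  have h : φ ∘ (fun s : F => a + s • b) =
      algebraMap F (F → F) (φ a) + ⇑(LinearMap.toSpanSingleton F F (φ b)) := by
    funext s; simp
  rw [h]
  exact add_mem ((polynomialFun F F).algebraMap_mem _) (dual_mem_polynomialFun _)

lemma polynomialFun_eq_iSup_homogeneousFun :
    (polynomialFun F E).toSubmodule = ⨆ d, homogeneousFun F E d := by
  refine le_antisymm ?_ (iSup_le fun d f => mem_polynomialFun_of_mem_homogeneousFun)
  rw [polynomialFun, Algebra.adjoin_eq_span, Submodule.span_le]
  intro f hf
  suffices ∃ d, f ∈ homogeneousFun F E d from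
    this.elim fun d hd => Submodule.mem_iSup_of_mem d hd
  induction hf using Submonoid.closure_induction with
  | mem f hf => exact ⟨1, by rwa [homogeneousFun, pow_one]⟩
  | one => exact ⟨0, by rw [homogeneousFun, pow_zero]; exact Submodule.one_le.1 le_rfl⟩
  | mul f g _ _ hf hg =>
    obtain ⟨⟨i, hi⟩, j, hj⟩ := And.intro hf hg
    exact ⟨i + j, by rw [homogeneousFun, pow_add]; exact Submodule.mul_mem_mul hi hj⟩

section Infinite

variable [Infinite F]

lemma polynomial_eq_of_forall_units {p q : Polynomial F}
    (h : ∀ s : Fˣ, p.eval (s : F) = q.eval (s : F)) : p = q :=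
  p.eq_of_infinite_eval_eq q <| (Set.finite_singleton 0).infinite_compl.mono fun s hs =>
    h (Units.mk0 s hs)

lemma polynomialFun_ext_units {n : ℕ} {f g : (Fin n → F) → F} (hf : f ∈ polynomialFun F (Fin n → F))
    (hg : g ∈ polynomialFun F (Fin n → F))
    (h : ∀ t : Fin n → Fˣ, f (fun i => t i) = g (fun i => t i)) : f = g := by
  obtain ⟨P, hP⟩ := (mem_polynomialFun_iff (Pi.basisFun F (Fin n))).1 hf
  obtain ⟨Q, hQ⟩ := (mem_polynomialFun_iff (Pi.basisFun F (Fin n))).1 hg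
  have hPQ : P = Q := by
    refine MvPolynomial.funext_set (fun _ => {0}ᶜ)
      (fun _ => (Set.finite_singleton 0).infinite_compl) fun t ht => ?_
    have := h fun i => Units.mk0 (t i) (ht i trivial)
    rwa [hP, hQ] at this
  funext x
  rw [hP, hQ, hPQ]

lemma polynomialFun_ext_GL {n : ℕ} {f g : Matrix (Fin n) (Fin n) F → F}
    (hf : f ∈ polynomialFun F (Matrix (Fin n) (Fin n) F))
    (hg : g ∈ polynomialFun F (Matrix (Fin n) (Fin n) F))
    (h : ∀ x : GL (Fin n) F, f x.val = g x.val) : f = g := by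
  obtain ⟨P, hP⟩ := mem_polynomialFun_matrix_iff.1 hf
  obtain ⟨Q, hQ⟩ := mem_polynomialFun_matrix_iff.1 hg
  have hPQ : P = Q := MvPolynomial.eq_of_eval_eq_on_gl fun x => by rw [← hP, ← hQ, h]
  funext x
  rw [hP, hQ, hPQ]

lemma exists_homogeneousFun_of_forall_units_smul {f : E → F} (hf : f ∈ polynomialFun F E) {d : ℕ}
    {S : Set E} (hS : ∀ x ∈ S, ∀ s : Fˣ, f ((s : F) • x) = (s : F) ^ d * f x) :
    ∃ h ∈ homogeneousFun F E d, ∀ x ∈ S, f x = h x := by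
  rw [← Subalgebra.mem_toSubmodule, polynomialFun_eq_iSup_homogeneousFun] at hf
  obtain ⟨h, hh, rfl⟩ := (Submodule.mem_iSup_iff_exists_finsupp _ _).1 hf
  refine ⟨h d, hh d, fun x hx => ?_⟩
  have hpoly : h.sum (fun i hi => Polynomial.monomial i (hi x)) =
      Polynomial.monomial d (h.sum (fun _ hi => hi) x) := by
    refine polynomial_eq_of_forall_units fun s => ?_
    have := hS x hx s
    simp only [Finsupp.sum, Finset.sum_apply, homogeneousFun_smul (hh _)] at this
    simp only [Finsupp.sum, Polynomial.eval_finsetSum, Polynomial.eval_monomial,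
      Finset.sum_apply, mul_comm _ ((s : F) ^ _), this]
  have := congrArg (Polynomial.coeff · d) hpoly
  simp only [Finsupp.sum, Polynomial.finsetSum_coeff, Polynomial.coeff_monomial,
    if_true] at this
  rw [Finsupp.sum, ← this, Finset.sum_ite_eq']
  split_ifs with hd
  · rfl
  · rw [Finsupp.notMem_support_iff.1 hd, Pi.zero_apply]

end Infinite

end PolynomialFunctions

/-! ### Weights -/

section Weights

variable {F : Type*} [Field F] {n : ℕ} {V : Type*} [AddCommGroup V] [Module F V]

lemma diag_one : diag (1 : Fin n → Fˣ) = 1 := by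
  apply Units.ext
  simp [diag]

lemma diag_mul (t t' : Fin n → Fˣ) : diag (t * t') = diag t * diag t' := by
  apply Units.ext
  simp [diag, Matrix.diagonal_mul_diagonal]

lemma det_diag (t : Fin n → Fˣ) : (diag t).val.det = ∏ i, (t i : F) :=
  Matrix.det_diagonal

lemma diag_const_val (s : Fˣ) : (diag fun _ : Fin n => s).val = (s : F) • 1 := by
  rw [Matrix.smul_one_eq_diagonal]
  rfl

lemma diag_mulSingle_val (i : Fin n) (s : Fˣ) : (diag (Pi.mulSingle i s)).val =
    (1 - Matrix.single i i (1 : F)) + (s : F) • Matrix.single i i 1 := by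
  ext j k
  by_cases hjk : j = k
  · subst hjk
    by_cases hj : j = i
    · simp [diag, hj]
    · simp [diag, hj, Ne.symm hj]
  · have : ¬ (i = j ∧ i = k) := fun h => hjk (h.1.symm.trans h.2)
    simp [diag, hjk, this]

/-- The character `t ↦ ∏ tᵢ ^ μᵢ` of the torus of diagonal matrices, with values in the field. -/
def torusChar (μ : Fin n → ℤ) : (Fin n → Fˣ) →* F where
  toFun t := ∏ i, (t i : F) ^ μ i
  map_one' := by simp
  map_mul' t t' := by simp [mul_zpow, Finset.prod_mul_distrib]

lemma torusChar_apply (μ : Fin n → ℤ) (t : Fin n → Fˣ) :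
    torusChar μ t = ∏ i, (t i : F) ^ μ i := rfl

lemma torusChar_mulSingle (μ : Fin n → ℤ) (i : Fin n) (s : Fˣ) :
    torusChar μ (Pi.mulSingle i s) = (s : F) ^ μ i := by
  rw [torusChar_apply, Finset.prod_eq_single i (fun j _ hj => by simp [hj]) (by simp),
    Pi.mulSingle_eq_same]

lemma torusChar_single (i : Fin n) (t : Fin n → Fˣ) :
    torusChar (F := F) (Pi.single i 1) t = t i := by
  rw [torusChar_apply, Finset.prod_eq_single i (fun j _ hj => by simp [hj]) (by simp),
    Pi.single_eq_same, zpow_one]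

lemma torusChar_const (μ : Fin n → ℤ) (s : Fˣ) :
    torusChar μ (fun _ => s) = (s : F) ^ ∑ i, μ i := by
  have h : ∏ i, s ^ μ i = s ^ ∑ i, μ i :=
    (map_sum (zpowersHom Fˣ s).toAdditiveRight _ _).symm
  simpa [torusChar_apply] using congrArg Units.val h

lemma nonneg_of_zpow_mul_eq_eval [Infinite F] {k : ℤ} {c : F} (hc : c ≠ 0) {q : Polynomial F}
    (h : ∀ s : Fˣ, (s : F) ^ k * c = q.eval (s : F)) : 0 ≤ k := by
  by_contra hk
  obtain ⟨j, rfl⟩ : ∃ j : ℕ, k = -(j + 1 : ℕ) := ⟨(-k - 1).toNat, by omega⟩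
  have hq : Polynomial.X ^ (j + 1) * q = Polynomial.C c := polynomial_eq_of_forall_units fun s => by
    rw [Polynomial.eval_mul, ← h s, zpow_neg, zpow_natCast, Polynomial.eval_pow, Polynomial.eval_X,
      mul_inv_cancel_left₀ (pow_ne_zero _ s.ne_zero), Polynomial.eval_C]
  exact hc (by simpa using (congrArg (Polynomial.eval 0) hq).symm)

lemma eq_of_zpow_eq_zpow [Infinite F] {k l : ℤ} (h : ∀ s : Fˣ, (s : F) ^ k = (s : F) ^ l) :
    k = l := by
  have key (k l : ℤ) (h : ∀ s : Fˣ, (s : F) ^ k = (s : F) ^ l) : 0 ≤ k - l :=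
    nonneg_of_zpow_mul_eq_eval (one_ne_zero (α := F)) (q := 1) fun s => by
      rw [zpow_sub₀ s.ne_zero, h s, div_self (zpow_ne_zero _ s.ne_zero), mul_one,
        Polynomial.eval_one]
  exact le_antisymm (sub_nonneg.1 (key l k fun s => (h s).symm)) (sub_nonneg.1 (key k l h))

lemma torusChar_injective [Infinite F] :
    Function.Injective (torusChar : (Fin n → ℤ) → (Fin n → Fˣ) →* F) := fun μ ν h =>
  funext fun i => eq_of_zpow_eq_zpow (F := F) fun s => by
    rw [← torusChar_mulSingle, h, torusChar_mulSingle]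

lemma linearIndependent_torusChar [Infinite F] :
    LinearIndependent F fun μ : Fin n → ℤ => (torusChar μ : (Fin n → Fˣ) → F) :=
  (linearIndependent_monoidHom (Fin n → Fˣ) F).comp _ torusChar_injective

variable (F n) in
/-- The algebra of regular functions on the torus of diagonal matrices. -/
def torusFun : Subalgebra F ((Fin n → Fˣ) → F) :=
  Algebra.adjoin F (Set.range fun μ : Fin n → ℤ => ⇑(torusChar μ))

lemma torusChar_mem_torusFun (μ : Fin n → ℤ) : ⇑(torusChar μ) ∈ torusFun F n :=
  Algebra.subset_adjoin ⟨μ, rfl⟩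

lemma torusFun_eq_span : (torusFun F n).toSubmodule =
    Submodule.span F (Set.range fun μ : Fin n → ℤ => ⇑(torusChar μ)) := by
  let M : Submonoid ((Fin n → Fˣ) → F) :=
    { carrier := Set.range fun μ : Fin n → ℤ => ⇑(torusChar μ)
      one_mem' := ⟨0, by funext t; simp [torusChar]⟩
      mul_mem' := by
        rintro _ _ ⟨μ, rfl⟩ ⟨ν, rfl⟩
        refine ⟨μ + ν, funext fun t => ?_⟩
        simp [torusChar, zpow_add₀, Finset.prod_mul_distrib] }
  rw [torusFun, Algebra.adjoin_eq_span]
  exact congrArg (Submodule.span F) (congrArg SetLike.coe (Submonoid.closure_eq M))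

lemma IsRational.coeff_diag_mem_torusFun {ρ : Representation F (GL (Fin n) F) V}
    (h : IsRational ρ) (φ : Module.Dual F V) (v : V) :
    (fun t => φ (ρ (diag t) v)) ∈ torusFun F n := by
  obtain ⟨P, k, hP⟩ := h.coeff φ v
  have hnum : (fun t : Fin n → Fˣ => MvPolynomial.eval (fun ij => (diag t).val ij.1 ij.2) P) ∈
      torusFun F n := by
    refine comp_mem_of_forall_dual_comp_mem (L := fun t => (diag t).val)
      (mem_polynomialFun_matrix_iff.2 ⟨P, fun x => rfl⟩) fun ψ => ?_
    have hψ : ψ ∘ (fun t => (diag t).val) = ∑ i, ψ (Matrix.single i i 1) •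
        ⇑(torusChar (F := F) (Pi.single i 1 : Fin n → ℤ)) := by
      funext t
      have hsum : (diag t).val = ∑ i, (t i : F) • Matrix.single i i (1 : F) := by
        simp [diag, Matrix.smul_single, Matrix.sum_single_eq_diagonal]
      simp only [Function.comp_apply, hsum, map_sum, map_smul, smul_eq_mul, Finset.sum_apply,
        Pi.smul_apply, torusChar_single, mul_comm]
    rw [hψ]
    exact sum_mem fun i _ => Subalgebra.smul_mem _ (torusChar_mem_torusFun _) _
  convert mul_mem hnum (torusChar_mem_torusFun (F := F) (n := n) fun _ => -k) using 1
  funext t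
  simp [hP, det_diag, torusChar, Finset.prod_pow]

lemma exists_finsupp_eq_sum_smul {X ι : Type*} [Module.Finite F V] (χ : ι → X → F) (f : X → V)
    (hf : ∀ φ : Module.Dual F V, φ ∘ f ∈ Submodule.span F (Set.range χ)) :
    ∃ w : ι →₀ V, ∀ x, f x = w.sum fun i v => χ i x • v := by
  let b := Module.finBasis F V
  choose c hc using fun j => (Finsupp.mem_span_range_iff_exists_finsupp (v := χ)).1 (hf (b.coord j))
  refine ⟨∑ j, (c j).mapRange (fun a => a • b j) (zero_smul F _), fun x => ?_⟩
  rw [← Finsupp.sum_finsetSum_index (by simp) (by simp), ← b.sum_repr (f x)]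
  refine Finset.sum_congr rfl fun j _ => ?_
  rw [Finsupp.sum_mapRange_index (by simp), ← b.coord_apply, ← Function.comp_apply (f := b.coord j),
    ← hc j, Finsupp.sum, Finset.sum_apply, Finset.sum_smul]
  exact Finset.sum_congr rfl fun i _ => by rw [Pi.smul_apply, smul_eq_mul, mul_comm, mul_smul]

lemma eq_zero_of_forall_sum_smul_eq_zero {X ι : Type*} {χ : ι → X → F}
    (hχ : LinearIndependent F χ) {s : Finset ι} {u : ι → V}
    (h : ∀ x, ∑ i ∈ s, χ i x • u i = 0) {i : ι} (hi : i ∈ s) : u i = 0 := by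
  rw [← Module.forall_dual_apply_eq_zero_iff F]
  refine fun φ => linearIndependent_iff'.1 hχ s (fun i => φ (u i)) (funext fun x => ?_) i hi
  simpa [mul_comm] using congrArg φ (h x)

/-- Expand `t ↦ ρ (diag t) v` in characters of the torus; by Dedekind's independence of
characters, the coefficients are weight vectors, and their sum is the value `v` at `t = 1`. -/
theorem IsRational.iSup_weightSpace [Infinite F] {ρ : Representation F (GL (Fin n) F) V}
    (h : IsRational ρ) : ⨆ μ, weightSpace ρ μ = ⊤ := by
  refine eq_top_iff.2 fun v _ => ?_
  have := h.finite
  obtain ⟨w, hw⟩ := exists_finsupp_eq_sum_smul (fun μ => ⇑(torusChar μ)) (fun t => ρ (diag t) v)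
    fun φ => torusFun_eq_span (F := F) (n := n) ▸ h.coeff_diag_mem_torusFun φ v
  have hweight : ∀ μ ∈ w.support, w μ ∈ weightSpace ρ μ := fun μ hμ t' => by
    refine sub_eq_zero.1 <| eq_zero_of_forall_sum_smul_eq_zero
      (linearIndependent_torusChar (F := F))
      (u := fun ν => ρ (diag t') (w ν) - torusChar ν t' • w ν) (fun t => ?_) hμ
    have htt' : ρ (diag (t' * t)) v = ρ (diag t') (ρ (diag t) v) := by
      rw [diag_mul, map_mul, Module.End.mul_apply]
    rw [hw, hw, Finsupp.sum, Finsupp.sum, map_sum] at htt'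
    simp only [smul_sub, Finset.sum_sub_distrib, ← map_smul]
    rw [← htt', sub_eq_zero]
    exact Finset.sum_congr rfl fun ν _ => by rw [map_mul, mul_comm, mul_smul]
  have hv := hw 1
  simp only [diag_one, map_one, Module.End.one_apply, one_smul] at hv
  rw [hv]
  exact Submodule.sum_mem _ fun μ hμ => Submodule.mem_iSup_of_mem μ (hweight μ hμ)

lemma IsRational.weight_induction [Infinite F] {ρ : Representation F (GL (Fin n) F) V}
    (h : IsRational ρ) {motive : V → Prop} (v : V)
    (mem : ∀ μ, ∀ v ∈ weightSpace ρ μ, motive v) (zero : motive 0)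
    (add : ∀ v w, motive v → motive w → motive (v + w)) : motive v :=
  Submodule.iSup_induction (motive := motive) (weightSpace ρ)
    (h.iSup_weightSpace ▸ Submodule.mem_top) mem zero add

end Weights

/-! ### Polynomial representations as homogeneous representations -/

section HomogeneousRep

variable {F : Type*} [Field F] {n d : ℕ} {V W : Type*} [AddCommGroup V] [Module F V]
  [AddCommGroup W] [Module F W]

/-- Finite-dimensional representations of `GL_n` whose matrix coefficients extend to homogeneous
polynomial functions of degree `d` on the space of all matrices. -/
structure IsHomogeneousRep (d : ℕ) (ρ : Representation F (GL (Fin n) F) V) : Prop where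
  finite : Module.Finite F V
  coeff : ∀ (φ : Module.Dual F V) (v : V),
    ∃ f ∈ homogeneousFun F (Matrix (Fin n) (Fin n) F) d, ∀ g : GL (Fin n) F, φ (ρ g v) = f g.val

variable {ρ : Representation F (GL (Fin n) F) V}

lemma det_val_ne_zero (g : GL (Fin n) F) : g.val.det ≠ 0 :=
  (g.isUnit.map Matrix.detMonoidHom).ne_zero

lemma exists_polynomialFun_of_forall_det_eq_zero [Infinite F] {c : GL (Fin n) F → F}
    (hc : ∃ (P : MvPolynomial (Fin n × Fin n) F) (k : ℕ), ∀ g : GL (Fin n) F,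
      c g = MvPolynomial.eval (fun ij => g.val ij.1 ij.2) P * (g.val.det ^ k)⁻¹)
    (hdet : ∀ f ∈ polynomialFun F (Matrix (Fin n) (Fin n) F), ∀ k : ℕ,
      (∀ g : GL (Fin n) F, c g = f g.val * (g.val.det ^ (k + 1))⁻¹) → ∀ x, x.det = 0 → f x = 0) :
    ∃ f ∈ polynomialFun F (Matrix (Fin n) (Fin n) F), ∀ g : GL (Fin n) F, c g = f g.val := by
  obtain ⟨P, k, hP⟩ := hc
  induction k generalizing P with
  | zero =>
    exact ⟨_, mem_polynomialFun_matrix_iff.2 ⟨P, fun x => rfl⟩, fun g => by rw [hP]; simp⟩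
  | succ k ih =>
    obtain ⟨Q, rfl⟩ := det_mvPolynomialX_dvd_of_forall_eval_eq_zero
      (hdet _ (mem_polynomialFun_matrix_iff.2 ⟨P, fun x => rfl⟩) k hP)
    refine ih Q fun g => ?_
    have := det_val_ne_zero g
    rw [hP, map_mul, Matrix.eval_det_mvPolynomialX, pow_succ']
    change g.val.det * _ * _ = _
    field_simp

lemma exists_homogeneousFun_of_forall_det_eq_zero [Infinite F] {c : GL (Fin n) F → F}
    (hc : ∃ (P : MvPolynomial (Fin n × Fin n) F) (k : ℕ), ∀ g : GL (Fin n) F,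
      c g = MvPolynomial.eval (fun ij => g.val ij.1 ij.2) P * (g.val.det ^ k)⁻¹)
    (hscalar : ∀ (s : Fˣ) (g : GL (Fin n) F), c ((diag fun _ => s) * g) = (s : F) ^ d * c g)
    (hdet : ∀ f ∈ polynomialFun F (Matrix (Fin n) (Fin n) F), ∀ k : ℕ,
      (∀ g : GL (Fin n) F, c g = f g.val * (g.val.det ^ (k + 1))⁻¹) → ∀ x, x.det = 0 → f x = 0) :
    ∃ f ∈ homogeneousFun F (Matrix (Fin n) (Fin n) F) d, ∀ g : GL (Fin n) F, c g = f g.val := by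
  obtain ⟨f, hf, hcf⟩ := exists_polynomialFun_of_forall_det_eq_zero hc hdet
  obtain ⟨q, hq, hfq⟩ := exists_homogeneousFun_of_forall_units_smul hf (d := d)
    (S := Set.range fun g : GL (Fin n) F => g.val) <| by
      rintro _ ⟨g, rfl⟩ s
      have hsg : ((diag fun _ => s) * g).val = (s : F) • g.val := by
        rw [Units.val_mul, diag_const_val, smul_mul_assoc, one_mul]
      rw [← hsg, ← hcf, hscalar, hcf]
  exact ⟨q, hq, fun g => (hcf g).trans (hfq _ ⟨g, rfl⟩)⟩

lemma IsHomogeneousRep.isRational (h : IsHomogeneousRep d ρ) : IsRational ρ := by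
  refine ⟨h.finite, fun φ v => ?_⟩
  obtain ⟨f, hf, hfρ⟩ := h.coeff φ v
  obtain ⟨P, hP⟩ := mem_polynomialFun_matrix_iff.1 (mem_polynomialFun_of_mem_homogeneousFun hf)
  exact ⟨P, 0, fun g => by rw [hfρ, hP, pow_zero, inv_one, mul_one]⟩

lemma IsHomogeneousRep.isPolynomial [Infinite F] (h : IsHomogeneousRep d ρ) :
    IsPolynomial d ρ := by
  refine ⟨h.isRational, fun μ hμ => ?_⟩
  obtain ⟨v, hv, hv0⟩ := (Submodule.ne_bot_iff _).1 hμ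
  obtain ⟨φ, hφ⟩ : ∃ φ : Module.Dual F V, φ v ≠ 0 := by
    simpa using mt (Module.forall_dual_apply_eq_zero_iff F v).1 hv0
  obtain ⟨f, hf, hfρ⟩ := h.coeff φ v
  have hfdiag (t : Fin n → Fˣ) : f (diag t).val = torusChar μ t * φ v := by
    rw [← hfρ, hv t, map_smul, smul_eq_mul, torusChar_apply]
  constructor
  · intro i
    obtain ⟨q, hq⟩ := exists_polynomial_eval_add_smul (mem_polynomialFun_of_mem_homogeneousFun hf)
      (1 - Matrix.single i i 1) (Matrix.single i i 1)
    refine nonneg_of_zpow_mul_eq_eval hφ (q := q) fun s => ?_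
    rw [← torusChar_mulSingle, ← hfdiag, diag_mulSingle_val, hq]
  · refine eq_of_zpow_eq_zpow (F := F) fun s => mul_right_cancel₀ hφ ?_
    have h1 := hfdiag 1
    rw [diag_one, Units.val_one, map_one, one_mul] at h1
    rw [← torusChar_const, ← hfdiag, diag_const_val, homogeneousFun_smul hf, h1, zpow_natCast]

lemma IsPolynomial.exists_coeff_diag_eq [Infinite F] (h : IsPolynomial d ρ) (φ : Module.Dual F V)
    (v : V) : ∃ f ∈ polynomialFun F (Fin n → F),
      ∀ t : Fin n → Fˣ, φ (ρ (diag t) v) = f fun i => t i := by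
  induction v using h.rational.weight_induction with
  | mem μ v hv =>
    by_cases hv0 : v = 0
    · exact ⟨0, zero_mem _, fun t => by simp [hv0]⟩
    · have hμ := (h.weights μ ((Submodule.ne_bot_iff _).2 ⟨v, hv, hv0⟩)).1
      refine ⟨φ v • fun t => ∏ i, t i ^ (μ i).toNat,
        Subalgebra.smul_mem _ (prod_pow_mem_polynomialFun _) _, fun t => ?_⟩
      have hpow (i : Fin n) : (t i : F) ^ μ i = (t i : F) ^ (μ i).toNat := by
        rw [← zpow_natCast, Int.toNat_of_nonneg (hμ i)]
      simp [hv t, hpow, mul_comm]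
  | zero => exact ⟨0, zero_mem _, fun t => by simp⟩
  | add v w hv hw =>
    obtain ⟨⟨f, hf, hfv⟩, g, hg, hgw⟩ := And.intro hv hw
    exact ⟨f + g, add_mem hf hg, fun t => by simp [hfv, hgw]⟩

lemma IsPolynomial.scalar_apply [Infinite F] (h : IsPolynomial d ρ) (s : Fˣ) (v : V) :
    ρ (diag fun _ => s) v = (s : F) ^ d • v := by
  induction v using h.rational.weight_induction with
  | mem μ v hv =>
    by_cases hv0 : v = 0
    · simp [hv0]
    · have hμ := (h.weights μ ((Submodule.ne_bot_iff _).2 ⟨v, hv, hv0⟩)).2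
      rw [hv, ← torusChar_apply, torusChar_const, hμ, zpow_natCast]
  | zero => simp
  | add v w hv hw => rw [map_add, hv, hw, smul_add]

lemma exists_eq_GL_mul_diagonal_mul_GL (x : Matrix (Fin n) (Fin n) F) :
    ∃ (g h : GL (Fin n) F) (D : Fin n → F), x = g.val * Matrix.diagonal D * h.val := by
  obtain ⟨L, L', D, hx⟩ := Matrix.Pivot.exists_list_transvec_mul_diagonal_mul_list_transvec x
  have hdet (L : List (Matrix.TransvectionStruct (Fin n) F)) :
      (L.map Matrix.TransvectionStruct.toMatrix).prod.det ≠ 0 := by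
    rw [Matrix.TransvectionStruct.det_toMatrix_prod]
    exact one_ne_zero
  exact ⟨.mkOfDetNeZero _ (hdet L), .mkOfDetNeZero _ (hdet L'), D, hx⟩

/-- Write the singular matrix as `g * diagonal D * g'`. On the matrices `g * diag t * g'` the
representation is polynomial in `t`, so that `f` is divisible by a power of `∏ tᵢ` there, and
`∏ Dᵢ = 0`. -/
lemma IsPolynomial.eq_zero_of_det_eq_zero [Infinite F] (h : IsPolynomial d ρ) {φ : Module.Dual F V}
    {v : V} {f : Matrix (Fin n) (Fin n) F → F}
    (hf : f ∈ polynomialFun F (Matrix (Fin n) (Fin n) F)) {k : ℕ}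
    (hfρ : ∀ g : GL (Fin n) F, φ (ρ g v) = f g.val * (g.val.det ^ (k + 1))⁻¹)
    {x : Matrix (Fin n) (Fin n) F} (hx : x.det = 0) : f x = 0 := by
  obtain ⟨g, g', D, rfl⟩ := exists_eq_GL_mul_diagonal_mul_GL x
  have hD : ∏ i, D i = 0 := by
    simpa [Matrix.det_mul, det_val_ne_zero] using hx
  obtain ⟨q, hq, hqρ⟩ := h.exists_coeff_diag_eq (φ ∘ₗ ρ g) (ρ g' v)
  let L : (Fin n → F) →ₗ[F] Matrix (Fin n) (Fin n) F :=
    LinearMap.mulRight F g'.val ∘ₗ LinearMap.mulLeft F g.val ∘ₗ Matrix.diagonalLinearMap (Fin n) F F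
  let c : F := g.val.det ^ (k + 1) * g'.val.det ^ (k + 1)
  have key : f ∘ L = c • (fun t => ∏ i, t i ^ (k + 1)) * q := by
    refine polynomialFun_ext_units (comp_mem_polynomialFun hf L)
      (mul_mem (Subalgebra.smul_mem _ (prod_pow_mem_polynomialFun _) _) hq) fun t => ?_
    have hgt := hfρ (g * diag t * g')
    simp only [map_mul, Module.End.mul_apply, Units.val_mul, Matrix.det_mul, det_diag] at hgt
    have ht : ∏ i, (t i : F) ≠ 0 := Finset.prod_ne_zero_iff.2 fun i _ => (t i).ne_zero
    have := det_val_ne_zero g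
    have := det_val_ne_zero g'
    rw [Pi.mul_apply, ← hqρ, LinearMap.comp_apply, hgt]
    simp only [Function.comp_apply, Pi.smul_apply, Finset.prod_pow, smul_eq_mul, c]
    change f (g.val * (diag t).val * g'.val) = _
    field_simp
    ring
  simpa [hD, L, Finset.prod_pow] using congrFun key D

theorem IsPolynomial.isHomogeneousRep [Infinite F] (h : IsPolynomial d ρ) :
    IsHomogeneousRep d ρ := by
  refine ⟨h.rational.finite, fun φ v => ?_⟩
  refine exists_homogeneousFun_of_forall_det_eq_zero (c := fun g => φ (ρ g v))
    (h.rational.coeff φ v) (fun s g => ?_) fun f hf k hfρ x => h.eq_zero_of_det_eq_zero hf hfρ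
  rw [map_mul, Module.End.mul_apply, h.scalar_apply, map_smul, smul_eq_mul]

end HomogeneousRep

/-! ### The extension to the monoid of all matrices -/

section HomogeneousMap

variable {F : Type*} [Field F] {d : ℕ} {E E' V W : Type*} [AddCommGroup E] [Module F E]
  [AddCommGroup E'] [Module F E'] [AddCommGroup V] [Module F V] [AddCommGroup W] [Module F W]

variable (F E V) in
/-- The homogeneous polynomial maps of degree `d` from `E` to `V`: those which become homogeneous
polynomial functions after composition with every linear form on `V`. -/
def homogeneousMap (d : ℕ) : Submodule F (E → V) where
  carrier := {f | ∀ φ : Module.Dual F V, φ ∘ f ∈ homogeneousFun F E d}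
  add_mem' {f g} hf hg φ := by
    convert add_mem (hf φ) (hg φ) using 1
    funext x; simp
  zero_mem' φ := by
    convert zero_mem (homogeneousFun F E d) using 1
    funext x; simp
  smul_mem' c f hf φ := by
    convert Submodule.smul_mem _ c (hf φ) using 1
    funext x; simp

lemma comp_linearMap_mem_homogeneousMap {f : E → V} (hf : f ∈ homogeneousMap F E V d)
    (L : E' →ₗ[F] E) : f ∘ L ∈ homogeneousMap F E' V d :=
  fun φ => comp_mem_homogeneousFun (hf φ) L

lemma linearMap_comp_mem_homogeneousMap {f : E → V} (hf : f ∈ homogeneousMap F E V d)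
    (L : V →ₗ[F] W) : L ∘ f ∈ homogeneousMap F E W d :=
  fun φ => hf (φ ∘ₗ L)

lemma homogeneousMap_ext_GL [Infinite F] {n : ℕ} {f g : Matrix (Fin n) (Fin n) F → V}
    (hf : f ∈ homogeneousMap F (Matrix (Fin n) (Fin n) F) V d)
    (hg : g ∈ homogeneousMap F (Matrix (Fin n) (Fin n) F) V d)
    (h : ∀ x : GL (Fin n) F, f x.val = g x.val) : f = g := by
  funext x
  rw [← sub_eq_zero, ← Module.forall_dual_apply_eq_zero_iff F]
  intro φ
  have := polynomialFun_ext_GL (mem_polynomialFun_of_mem_homogeneousFun (hf φ))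
    (mem_polynomialFun_of_mem_homogeneousFun (hg φ)) fun x => congrArg φ (h x)
  simpa [sub_eq_zero] using congrFun this x

lemma exists_homogeneousMap_eq_comp [Module.Finite F V] {X : Type*} {ι : X → E} {f : X → V}
    (hf : ∀ φ : Module.Dual F V, ∃ h ∈ homogeneousFun F E d, ∀ x, φ (f x) = h (ι x)) :
    ∃ h ∈ homogeneousMap F E V d, ∀ x, f x = h (ι x) := by
  let b := Module.finBasis F V
  choose h hh hfh using fun i => hf (b.coord i)
  refine ⟨fun x => ∑ i, h i x • b i, fun φ => ?_, fun x => ?_⟩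
  · convert Submodule.sum_mem (homogeneousFun F E d) (t := Finset.univ)
      fun i _ => Submodule.smul_mem _ (φ (b i)) (hh i) using 1
    funext x
    simp [mul_comm]
  · rw [← b.sum_repr (f x)]
    exact Finset.sum_congr rfl fun i _ => by rw [← hfh, b.coord_apply]

instance [Module.Finite F E] [Module.Finite F V] : Module.Finite F (homogeneousMap F E V d) := by
  let b := Module.finBasis F V
  let coords : homogeneousMap F E V d →ₗ[F] Fin (Module.finrank F V) → homogeneousFun F E d :=
    { toFun f i := ⟨b.coord i ∘ f.1, f.2 _⟩
      map_add' f g := by ext; simp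
      map_smul' c f := by ext; simp }
  refine Module.Finite.of_injective coords fun f g hfg => Subtype.ext (funext fun x => ?_)
  exact b.ext_elem fun i => congrFun (congrArg Subtype.val (congrFun hfg i)) x

end HomogeneousMap

namespace IsHomogeneousRep

variable {F : Type*} [Field F] {n d : ℕ} {V W : Type*} [AddCommGroup V] [Module F V]
  [AddCommGroup W] [Module F W] {ρ : Representation F (GL (Fin n) F) V}
  {σ : Representation F (GL (Fin n) F) W}

lemma of_surjective (hρ : IsHomogeneousRep d ρ) {f : V →ₗ[F] W} (hf : Function.Surjective f)
    (hfρ : ∀ g v, f (ρ g v) = σ g (f v)) : IsHomogeneousRep d σ := by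
  have := hρ.finite
  refine ⟨Module.Finite.of_surjective f hf, fun φ w => ?_⟩
  obtain ⟨v, rfl⟩ := hf w
  obtain ⟨h, hh, hhρ⟩ := hρ.coeff (φ ∘ₗ f) v
  exact ⟨h, hh, fun g => by rw [← hfρ, ← hhρ, LinearMap.comp_apply]⟩

lemma of_separating [Module.Finite F V] {S : Set (Module.Dual F V)}
    (hS : ∀ v, (∀ φ ∈ S, φ v = 0) → v = 0)
    (hcoeff : ∀ φ ∈ S, ∀ v, ∃ f ∈ homogeneousFun F (Matrix (Fin n) (Fin n) F) d,
      ∀ g : GL (Fin n) F, φ (ρ g v) = f g.val) : IsHomogeneousRep d ρ := by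
  refine ⟨inferInstance, fun φ => ?_⟩
  have hspan : Submodule.span F S = ⊤ := by
    rw [← Subspace.dualCoannihilator_dualAnnihilator_eq (W := Submodule.span F S),
      Submodule.dualAnnihilator_eq_top_iff]
    refine (Submodule.eq_bot_iff _).2 fun v hv => hS v fun φ hφ => ?_
    exact (Submodule.mem_dualCoannihilator _).1 hv φ (Submodule.subset_span hφ)
  induction (hspan ▸ Submodule.mem_top : φ ∈ Submodule.span F S) using
    Submodule.span_induction with
  | mem φ hφ => exact hcoeff φ hφ
  | zero => exact fun v => ⟨0, zero_mem _, fun g => rfl⟩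
  | add φ ψ _ _ hφ hψ =>
    intro v
    obtain ⟨⟨f, hf, hfφ⟩, f', hf', hfψ⟩ := And.intro (hφ v) (hψ v)
    exact ⟨f + f', add_mem hf hf', fun g => by simp [hfφ, hfψ]⟩
  | smul c φ _ hφ =>
    intro v
    obtain ⟨f, hf, hfφ⟩ := hφ v
    exact ⟨c • f, Submodule.smul_mem _ c hf, fun g => by simp [hfφ]⟩

lemma exists_homogeneousMap (hρ : IsHomogeneousRep d ρ) (v : V) :
    ∃ f ∈ homogeneousMap F (Matrix (Fin n) (Fin n) F) V d, ∀ g : GL (Fin n) F, ρ g v = f g.val :=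
  have := hρ.finite
  exists_homogeneousMap_eq_comp fun φ => hρ.coeff φ v

/-- The homogeneous polynomial map extending the orbit map `g ↦ ρ g v` to all matrices. -/
def orbitMap (hρ : IsHomogeneousRep d ρ) (v : V) : Matrix (Fin n) (Fin n) F → V :=
  (hρ.exists_homogeneousMap v).choose

section OrbitMap

variable (hρ : IsHomogeneousRep d ρ) (v : V)

lemma orbitMap_mem : hρ.orbitMap v ∈ homogeneousMap F (Matrix (Fin n) (Fin n) F) V d :=
  (hρ.exists_homogeneousMap v).choose_spec.1

lemma orbitMap_GL (g : GL (Fin n) F) : hρ.orbitMap v g.val = ρ g v :=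
  ((hρ.exists_homogeneousMap v).choose_spec.2 g).symm

variable [Infinite F]

lemma orbitMap_GL_mul (g : GL (Fin n) F) (x : Matrix (Fin n) (Fin n) F) :
    hρ.orbitMap v (g.val * x) = ρ g (hρ.orbitMap v x) :=
  congrFun (homogeneousMap_ext_GL
    (comp_linearMap_mem_homogeneousMap (hρ.orbitMap_mem v) (LinearMap.mulLeft F g.val))
    (linearMap_comp_mem_homogeneousMap (hρ.orbitMap_mem v) (ρ g)) fun h => by
      simp only [Function.comp_apply, LinearMap.mulLeft_apply, ← Units.val_mul, orbitMap_GL,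
        map_mul, Module.End.mul_apply]) x

lemma orbitMap_mul (x y : Matrix (Fin n) (Fin n) F) :
    hρ.orbitMap v (x * y) = hρ.orbitMap (hρ.orbitMap v y) x :=
  congrFun (homogeneousMap_ext_GL
    (comp_linearMap_mem_homogeneousMap (hρ.orbitMap_mem v) (LinearMap.mulRight F y))
    (hρ.orbitMap_mem _) fun g => by
      rw [Function.comp_apply, LinearMap.mulRight_apply, orbitMap_GL_mul, orbitMap_GL]) x

end OrbitMap

variable [Infinite F]

/-- The action of the monoid of all matrices that extends a homogeneous representation. -/
def mat (hρ : IsHomogeneousRep d ρ) : Matrix (Fin n) (Fin n) F →* Module.End F V where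
  toFun x :=
    { toFun v := hρ.orbitMap v x
      map_add' v w := congrFun (homogeneousMap_ext_GL (hρ.orbitMap_mem _)
        (add_mem (hρ.orbitMap_mem v) (hρ.orbitMap_mem w)) fun g => by simp [orbitMap_GL]) x
      map_smul' c v := congrFun (homogeneousMap_ext_GL (hρ.orbitMap_mem _)
        (Submodule.smul_mem _ c (hρ.orbitMap_mem v)) fun g => by simp [orbitMap_GL]) x }
  map_one' := LinearMap.ext fun v => by
    simpa using hρ.orbitMap_GL v 1
  map_mul' x y := LinearMap.ext fun v => hρ.orbitMap_mul v x y

lemma mat_val (hρ : IsHomogeneousRep d ρ) (g : GL (Fin n) F) : hρ.mat g.val = ρ g :=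
  LinearMap.ext fun v => hρ.orbitMap_GL v g

lemma mat_mem_homogeneousMap (hρ : IsHomogeneousRep d ρ) (v : V) :
    (fun x => hρ.mat x v) ∈ homogeneousMap F (Matrix (Fin n) (Fin n) F) V d :=
  hρ.orbitMap_mem v

lemma map_mat (hρ : IsHomogeneousRep d ρ) (hσ : IsHomogeneousRep d σ) {f : V →ₗ[F] W}
    (hf : ∀ g v, f (ρ g v) = σ g (f v)) (x : Matrix (Fin n) (Fin n) F) (v : V) :
    f (hρ.mat x v) = hσ.mat x (f v) :=
  congrFun (homogeneousMap_ext_GL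
    (linearMap_comp_mem_homogeneousMap (hρ.mat_mem_homogeneousMap v) f)
    (hσ.mat_mem_homogeneousMap (f v)) fun g => by simp [mat_val, hf]) x

lemma mat_mem (hρ : IsHomogeneousRep d ρ) {K : Submodule F V} (hK : ∀ g, ∀ v ∈ K, ρ g v ∈ K)
    (x : Matrix (Fin n) (Fin n) F) {v : V} (hv : v ∈ K) : hρ.mat x v ∈ K := by
  rw [← K.ker_mkQ, LinearMap.mem_ker]
  exact congrFun (homogeneousMap_ext_GL
    (linearMap_comp_mem_homogeneousMap (hρ.mat_mem_homogeneousMap v) K.mkQ) (zero_mem _)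
    fun g => by simpa [mat_val] using hK g v hv) x

end IsHomogeneousRep

/-! ### Truncation -/

section Truncation

variable {F : Type*} [Field F] {n d : ℕ}

variable (F n) in
/-- The matrix `(1 | 0)` of the projection `F^{n+1} → F^n` that forgets the last coordinate. -/
def initProj : Matrix (Fin n) (Fin (n + 1)) F :=
  (1 : Matrix (Fin (n + 1)) (Fin (n + 1)) F).submatrix Fin.castSucc id

variable (F n) in
/-- The matrix of the inclusion `F^n → F^{n+1}` whose image is the hyperplane where the last
coordinate vanishes. -/
def initIncl : Matrix (Fin (n + 1)) (Fin n) F :=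
  (1 : Matrix (Fin (n + 1)) (Fin (n + 1)) F).submatrix id Fin.castSucc

variable (F n) in
/-- The matrix unit whose only nonzero entry is the last one on the diagonal. -/
def lastUnit : Matrix (Fin (n + 1)) (Fin (n + 1)) F :=
  Matrix.single (Fin.last n) (Fin.last n) 1

section Entries

variable (i j : Fin n)

@[simp]
lemma initProj_castSucc : initProj F n i j.castSucc = if i = j then 1 else 0 := by
  simp [initProj, Matrix.one_apply]

@[simp]
lemma initProj_last : initProj F n i (Fin.last n) = 0 := by
  simp [initProj]

@[simp]
lemma initIncl_castSucc : initIncl F n i.castSucc j = if i = j then 1 else 0 := by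
  simp [initIncl, Matrix.one_apply]

@[simp]
lemma initIncl_last : initIncl F n (Fin.last n) j = 0 := by
  simp [initIncl, (Fin.castSucc_ne_last j).symm]

end Entries

@[simp]
lemma initProj_mul_initIncl : initProj F n * initIncl F n = 1 := by
  ext i j
  simp [Matrix.mul_apply, Fin.sum_univ_castSucc, Matrix.one_apply]

@[simp]
lemma initProj_mul_initIncl_mul {m : Type*} (x : Matrix (Fin n) m F) :
    initProj F n * (initIncl F n * x) = x := by
  rw [← Matrix.mul_assoc, initProj_mul_initIncl, Matrix.one_mul]

lemma initIncl_mul_initProj :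
    initIncl F n * initProj F n = 1 - lastUnit F n := by
  ext i j
  refine Fin.lastCases ?_ (fun i => ?_) i <;> refine Fin.lastCases ?_ (fun j => ?_) j <;>
    simp [lastUnit, Matrix.mul_apply, Matrix.one_apply,
      (Fin.castSucc_ne_last _).symm]

lemma initProj_mul_embed (g : GL (Fin n) F) :
    initProj F n * (embed g).val = g.val * initProj F n := by
  ext i j
  refine Fin.lastCases ?_ (fun j => ?_) j <;>
    simp [Matrix.mul_apply, Fin.sum_univ_castSucc, embed_castSucc_last, embed_castSucc]

lemma embed_mul_initIncl (g : GL (Fin n) F) :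
    (embed g).val * initIncl F n = initIncl F n * g.val := by
  ext i j
  refine Fin.lastCases ?_ (fun i => ?_) i <;>
    simp [Matrix.mul_apply, Fin.sum_univ_castSucc, embed_last_castSucc, embed_castSucc]

lemma subtorus_eq_diag_mulSingle (s : Fˣ) :
    subtorus (n := n) s = diag (Pi.mulSingle (Fin.last n) s) := by
  refine congrArg diag (funext fun i => ?_)
  refine Fin.lastCases ?_ (fun i => ?_) i <;> simp

lemma subtorus_val (s : Fˣ) : (subtorus (n := n) s).val =
    initIncl F n * initProj F n + (s : F) • lastUnit F n := by
  rw [subtorus_eq_diag_mulSingle, diag_mulSingle_val, initIncl_mul_initProj, lastUnit]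

lemma lastUnit_mul_initIncl : lastUnit F n * initIncl F n = 0 := by
  ext i j
  simp [lastUnit, Matrix.mul_apply, Fin.sum_univ_castSucc, Matrix.single_apply,
    (Fin.castSucc_ne_last _).symm]

lemma subtorus_mul_initIncl (s : Fˣ) :
    (subtorus (n := n) s).val * initIncl F n = initIncl F n := by
  rw [subtorus_val, Matrix.add_mul, Matrix.mul_assoc, initProj_mul_initIncl, Matrix.mul_one,
    Matrix.smul_mul, lastUnit_mul_initIncl, smul_zero, add_zero]

variable (F n) in
/-- The linear map `a ↦ diag(a, 0)` that extends a matrix by a zero row and a zero column. -/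
def extendZero : Matrix (Fin n) (Fin n) F →ₗ[F] Matrix (Fin (n + 1)) (Fin (n + 1)) F where
  toFun a := initIncl F n * a * initProj F n
  map_add' a b := by rw [Matrix.mul_add, Matrix.add_mul]
  map_smul' c a := by simp

lemma extendZero_apply (a : Matrix (Fin n) (Fin n) F) :
    extendZero F n a = initIncl F n * a * initProj F n := rfl

lemma extendZero_one : extendZero F n 1 = initIncl F n * initProj F n := by
  rw [extendZero_apply, Matrix.mul_one]

lemma extendZero_mul (a b : Matrix (Fin n) (Fin n) F) :
    extendZero F n (a * b) = extendZero F n a * extendZero F n b := by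
  simp only [extendZero_apply, Matrix.mul_assoc, initProj_mul_initIncl_mul]

lemma embed_mul_extendZero_one (g : GL (Fin n) F) :
    (embed g).val * extendZero F n 1 = extendZero F n g.val := by
  rw [extendZero_one, ← Matrix.mul_assoc, embed_mul_initIncl, extendZero_apply]

lemma subtorus_mul_extendZero (s : Fˣ) (a : Matrix (Fin n) (Fin n) F) :
    (subtorus (n := n) s).val * extendZero F n a = extendZero F n a := by
  rw [extendZero_apply, ← Matrix.mul_assoc, ← Matrix.mul_assoc, subtorus_mul_initIncl]

end Truncation

section Invariants

variable {F : Type*} [Field F] [Infinite F] {n d : ℕ} {V : Type*} [AddCommGroup V] [Module F V]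
  {ρ : Representation F (GL (Fin (n + 1)) F) V}

lemma IsHomogeneousRep.mem_invariants_iff (hρ : IsHomogeneousRep d ρ) {v : V} :
    v ∈ invariants ρ ↔ hρ.mat (extendZero F n 1) v = v := by
  refine ⟨fun hv => ?_, fun hv s => ?_⟩
  · rw [← sub_eq_zero, ← Module.forall_dual_apply_eq_zero_iff F]
    intro φ
    obtain ⟨q, hq⟩ := exists_polynomial_eval_add_smul
      (mem_polynomialFun_of_mem_homogeneousFun (hρ.mat_mem_homogeneousMap v φ))
      (extendZero F n 1) (lastUnit F n)
    have hqC : q = Polynomial.C (φ v) := polynomial_eq_of_forall_units fun s => by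
      rw [← hq, extendZero_one, ← subtorus_val, Polynomial.eval_C, Function.comp_apply,
        hρ.mat_val, hv s]
    have hq0 := hq 0
    rw [zero_smul, add_zero, hqC, Polynomial.eval_C] at hq0
    rw [map_sub, sub_eq_zero, ← hq0, Function.comp_apply]
  · rw [← hv, ← hρ.mat_val, ← Module.End.mul_apply, ← map_mul, subtorus_mul_extendZero]

lemma IsHomogeneousRep.mat_extendZero_mem_invariants (hρ : IsHomogeneousRep d ρ)
    (a : Matrix (Fin n) (Fin n) F) (v : V) : hρ.mat (extendZero F n a) v ∈ invariants ρ := by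
  rw [hρ.mem_invariants_iff, ← Module.End.mul_apply, ← map_mul, ← extendZero_mul, one_mul]

lemma IsHomogeneousRep.invRep (hρ : IsHomogeneousRep d ρ) : IsHomogeneousRep d (invRep ρ) :=
  (invRep_isPolynomial hρ.isPolynomial).isHomogeneousRep

lemma IsHomogeneousRep.coe_invRep_mat (hρ : IsHomogeneousRep d ρ) (a : Matrix (Fin n) (Fin n) F)
    (v : invariants ρ) : (hρ.invRep.mat a v : V) = hρ.mat (extendZero F n a) v :=
  congrFun (homogeneousMap_ext_GL
    (linearMap_comp_mem_homogeneousMap (hρ.invRep.mat_mem_homogeneousMap v)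
      (invariants ρ).subtype)
    (comp_linearMap_mem_homogeneousMap (hρ.mat_mem_homogeneousMap (v : V)) (extendZero F n))
    fun g => by
      rw [Function.comp_apply, Function.comp_apply, hρ.invRep.mat_val, Submodule.subtype_apply,
        invRep_coe, ← embed_mul_extendZero_one, map_mul, Module.End.mul_apply, hρ.mat_val,
        hρ.mem_invariants_iff.1 v.2]) a

end Invariants

/-! ### Weyl modules are homogeneous -/

section HighestWeight

variable {F : Type*} [Field F] {n d : ℕ} {V : Type*} [AddCommGroup V] [Module F V]

/-- Highest weight vectors of weight `wt`: the vectors on which the upper triangular matrices act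
through the character `b ↦ ∏ bᵢᵢ ^ wtᵢ`. -/
def IsHighestWeightVec (ρ : Representation F (GL (Fin n) F) V) (wt : Fin n → ℤ) (v : V) : Prop :=
  ∀ b : GL (Fin n) F, b.val.BlockTriangular id → ρ b v = borelChar wt b • v

lemma apply_self_ne_zero_of_blockTriangular {b : GL (Fin n) F} (hb : b.val.BlockTriangular id)
    (i : Fin n) : b.val i i ≠ 0 := by
  have hdet := det_val_ne_zero b
  rw [Matrix.det_of_isUpperTriangular hb] at hdet
  exact Finset.prod_ne_zero_iff.1 hdet i (Finset.mem_univ i)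

lemma borelChar_mul_det_pow (wt : Fin n → ℤ) (k : ℕ) {b : GL (Fin n) F}
    (hb : b.val.BlockTriangular id) :
    borelChar wt b * b.val.det ^ k = borelChar (fun i => wt i + k) b := by
  rw [Matrix.det_of_isUpperTriangular hb, ← Finset.prod_pow, borelChar, borelChar,
    ← Finset.prod_mul_distrib]
  refine Finset.prod_congr rfl fun i _ => ?_
  rw [zpow_add₀ (apply_self_ne_zero_of_blockTriangular hb i), zpow_natCast]

lemma borelChar_diag (wt : Fin n → ℤ) (t : Fin n → Fˣ) :
    borelChar wt (diag t) = torusChar wt t := by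
  simp [borelChar, diag, torusChar_apply]

/-- A vector in the kernel, scaled to have last nonzero entry `1`, is a column of a unipotent upper
triangular matrix. -/
lemma exists_blockTriangular_mul_col_eq_zero {x : Matrix (Fin n) (Fin n) F} (hx : x.det = 0) :
    ∃ (b : GL (Fin n) F) (i : Fin n), b.val.BlockTriangular id ∧ ∀ j, (x * b.val) j i = 0 := by
  obtain ⟨w, hw0, hxw⟩ := Matrix.exists_mulVec_eq_zero_iff.2 hx
  obtain ⟨i, hi, hlast⟩ : ∃ i, w i ≠ 0 ∧ ∀ j, i < j → w j = 0 := by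
    obtain ⟨i, hi⟩ := (Set.toFinite {i | w i ≠ 0}).exists_maximal (Function.ne_iff.1 hw0)
    exact ⟨i, hi.1, fun j hij => by_contra fun hj => hij.not_ge (hi.2 hj hij.le)⟩
  let b : Matrix (Fin n) (Fin n) F := (1 : Matrix (Fin n) (Fin n) F).updateCol i w
  have hb : b.BlockTriangular id := fun j k hkj => by
    by_cases hki : k = i
    · subst hki
      simpa [b] using hlast j hkj
    · simp [b, hki, (show k < j from hkj).ne']
  have hbdet : b.det ≠ 0 := by
    rw [Matrix.det_of_isUpperTriangular hb, Finset.prod_ne_zero_iff]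
    intro j _
    by_cases hji : j = i
    · subst hji
      simpa [b] using hi
    · simp [b, hji]
  refine ⟨.mkOfDetNeZero b hbdet, i, hb, fun j => ?_⟩
  change (x * b) j i = 0
  simpa [b, Matrix.mul_updateCol] using congrFun hxw j

lemma eq_zero_of_forall_mul_borel [Infinite F] {f : Matrix (Fin n) (Fin n) F → F}
    (hf : f ∈ polynomialFun F (Matrix (Fin n) (Fin n) F)) {wt : Fin n → ℤ} (hwt : ∀ i, wt i ≠ 0)
    (hfb : ∀ b : GL (Fin n) F, b.val.BlockTriangular id →
      ∀ g : GL (Fin n) F, f (g * b).val = borelChar wt b * f g.val)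
    {x : Matrix (Fin n) (Fin n) F} (hx : x.det = 0) : f x = 0 := by
  have hfb' (b : GL (Fin n) F) (hb : b.val.BlockTriangular id) (y : Matrix (Fin n) (Fin n) F) :
      f (y * b.val) = borelChar wt b * f y :=
    congrFun (polynomialFun_ext_GL (comp_mem_polynomialFun hf (LinearMap.mulRight F b.val))
      (Subalgebra.smul_mem _ hf (borelChar wt b)) fun g => hfb b hb g) y
  obtain ⟨b, i, hb, hcol⟩ := exists_blockTriangular_mul_col_eq_zero hx
  have hxb (s : Fˣ) : x * b.val * (diag (Pi.mulSingle i s)).val = x * b.val := by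
    ext j k
    by_cases hk : k = i
    · subst hk
      simp [diag, hcol]
    · simp [diag, hk]
  have hb0 : borelChar wt b ≠ 0 := Finset.prod_ne_zero_iff.2 fun j _ =>
    zpow_ne_zero _ (apply_self_ne_zero_of_blockTriangular hb j)
  have hfxb : f (x * b.val) = 0 := by
    by_contra hne
    refine hwt i (eq_of_zpow_eq_zpow (F := F) fun s => mul_right_cancel₀ hne ?_)
    have hs := hfb' (diag (Pi.mulSingle i s)) (Matrix.blockTriangular_diagonal _) (x * b.val)
    rw [hxb, borelChar_diag, torusChar_mulSingle] at hs
    rw [← hs, zpow_zero, one_mul]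
  exact (mul_eq_zero.1 ((hfb' b hb x).symm.trans hfxb)).resolve_left hb0

theorem IsHighestWeightVec.exists_homogeneousFun [Infinite F]
    {ρ : Representation F (GL (Fin n) F) V} (hρ : IsRational ρ) {wt : Fin n → ℤ} {v : V}
    (hv : IsHighestWeightVec ρ wt v) (hwt : ∀ i, 0 ≤ wt i) (hd : ∑ i, wt i = d)
    (φ : Module.Dual F V) : ∃ f ∈ homogeneousFun F (Matrix (Fin n) (Fin n) F) d,
      ∀ g : GL (Fin n) F, φ (ρ g v) = f g.val := by
  refine exists_homogeneousFun_of_forall_det_eq_zero (c := fun g => φ (ρ g v)) (hρ.coeff φ v)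
    (fun s g => ?_) fun f hf k hfρ x => ?_
  · have hcomm : (diag fun _ => s) * g = g * diag fun _ => s := by
      apply Units.ext
      rw [Units.val_mul, Units.val_mul, diag_const_val, smul_mul_assoc, mul_smul_comm, one_mul,
        mul_one]
    rw [hcomm, map_mul, Module.End.mul_apply, hv _ (Matrix.blockTriangular_diagonal _),
      borelChar_diag, torusChar_const, hd, map_smul, map_smul, zpow_natCast, smul_eq_mul]
  · refine eq_zero_of_forall_mul_borel hf (wt := fun i => wt i + (k + 1 : ℕ))
      (fun i => by have := hwt i; omega) fun b hb g => ?_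
    have hgb := hfρ (g * b)
    rw [map_mul, Module.End.mul_apply, hv b hb, map_smul, map_smul, smul_eq_mul, hfρ g,
      eq_mul_inv_iff_mul_eq₀ (pow_ne_zero _ (det_val_ne_zero _)), Units.val_mul,
      Matrix.det_mul, mul_pow] at hgb
    rw [← borelChar_mul_det_pow wt (k + 1) hb, Units.val_mul, ← hgb]
    have := det_val_ne_zero g
    field_simp

end HighestWeight

section Weyl

variable {F : Type u} [Field F] {n d : ℕ}

variable (F n d) in
/-- The map from the group algebra of `GL_n` to the Schur algebra, realized as the dual of the
space of homogeneous polynomial functions: an element of the group algebra is sent to the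
evaluation of functions at it. -/
def schurEval :
    F[GL (Fin n) F] →ₗ[F] Module.Dual F (homogeneousFun F (Matrix (Fin n) (Fin n) F) d) :=
  (Finsupp.linearCombination F fun g : GL (Fin n) F =>
    LinearMap.proj g.val ∘ₗ (homogeneousFun F (Matrix (Fin n) (Fin n) F) d).subtype) ∘ₗ
      (MonoidAlgebra.coeffLinearEquiv F).toLinearMap

lemma schurEval_single (g : GL (Fin n) F) (r : F)
    (f : homogeneousFun F (Matrix (Fin n) (Fin n) F) d) :
    schurEval F n d (MonoidAlgebra.single g r) f = r * f.1 g.val := by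
  simp [schurEval]

lemma eq_schurEval {ψ : F[GL (Fin n) F] →ₗ[F] F}
    {f : homogeneousFun F (Matrix (Fin n) (Fin n) F) d}
    (h : ∀ g, ψ (MonoidAlgebra.single g 1) = f.1 g.val) (x : F[GL (Fin n) F]) :
    ψ x = schurEval F n d x f := by
  induction x using MonoidAlgebra.induction_linear with
  | zero => simp
  | add x y hx hy => rw [map_add, map_add, hx, hy, LinearMap.add_apply]
  | single g r =>
    rw [schurEval_single, ← h, ← smul_eq_mul, ← map_smul, MonoidAlgebra.smul_single, smul_eq_mul,
      mul_one]

variable {J : Submodule (F[GL (Fin n) F]) (F[GL (Fin n) F])}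

lemma schurEval_ker_le
    (hJ : ∀ φ : Module.Dual F (F[GL (Fin n) F] ⧸ J), ∃ f ∈ homogeneousFun F (Matrix _ _ F) d,
      ∀ g : GL (Fin n) F, φ (J.mkQ (MonoidAlgebra.single g 1)) = f g.val) :
    LinearMap.ker (schurEval F n d) ≤ J.restrictScalars F := by
  intro x hx
  rw [Submodule.restrictScalars_mem, ← J.ker_mkQ, LinearMap.mem_ker,
    ← Module.forall_dual_apply_eq_zero_iff F]
  intro φ
  obtain ⟨f, hf, hfφ⟩ := hJ φ
  have := eq_schurEval (ψ := φ ∘ₗ J.mkQ.restrictScalars F) (f := ⟨f, hf⟩) hfφ x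
  rwa [LinearMap.mem_ker.1 hx] at this

lemma exists_homogeneousFun_of_schurEval_ker_le
    (hJ : LinearMap.ker (schurEval F n d) ≤ J.restrictScalars F)
    (φ : Module.Dual F (F[GL (Fin n) F] ⧸ J)) : ∃ f ∈ homogeneousFun F (Matrix _ _ F) d,
      ∀ g : GL (Fin n) F, φ (J.mkQ (MonoidAlgebra.single g 1)) = f g.val := by
  have hφ : φ ∘ₗ J.mkQ.restrictScalars F ∈ LinearMap.range (schurEval F n d).dualMap := by
    rw [LinearMap.range_dualMap_eq_dualAnnihilator_ker, Submodule.mem_dualAnnihilator]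
    intro x hx
    have : J.mkQ x = 0 := (Submodule.Quotient.mk_eq_zero J).2 (hJ hx)
    simp [this]
  obtain ⟨α, hα⟩ := hφ
  obtain ⟨f, rfl⟩ := (Module.evalEquiv F _).surjective α
  refine ⟨f.1, f.2, fun g => ?_⟩
  have := LinearMap.congr_fun hα (MonoidAlgebra.single g 1)
  rw [LinearMap.dualMap_apply, Module.evalEquiv_apply, Module.Dual.eval_apply, schurEval_single,
    one_mul] at this
  exact this.symm

lemma ofModule'_mkQ (g : GL (Fin n) F) (x : F[GL (Fin n) F]) :
    Representation.ofModule' (k := F) (F[GL (Fin n) F] ⧸ J) g (J.mkQ x) =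
      J.mkQ (MonoidAlgebra.single g 1 * x) := rfl

lemma isHomogeneousRep_of_schurEval_ker_le
    (hJ : LinearMap.ker (schurEval F n d) ≤ J.restrictScalars F) :
    IsHomogeneousRep d
      (Representation.ofModule' (k := F) (G := GL (Fin n) F) (F[GL (Fin n) F] ⧸ J)) := by
  let q : F[GL (Fin n) F] →ₗ[F] (F[GL (Fin n) F] ⧸ J) := J.mkQ.restrictScalars F
  refine ⟨?_, fun φ v => ?_⟩
  · have : Module.Finite F (F[GL (Fin n) F] ⧸ LinearMap.ker (schurEval F n d)) :=
      Module.Finite.equiv (schurEval F n d).quotKerEquivRange.symm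
    refine Module.Finite.of_surjective ((LinearMap.ker (schurEval F n d)).liftQ q fun x hx =>
      (Submodule.Quotient.mk_eq_zero J).2 (hJ hx)) fun v => ?_
    obtain ⟨x, rfl⟩ := J.mkQ_surjective v
    exact ⟨Submodule.Quotient.mk x, rfl⟩
  · obtain ⟨f, hf, hfφ⟩ := exists_homogeneousFun_of_schurEval_ker_le hJ φ
    obtain ⟨x, rfl⟩ := J.mkQ_surjective v
    simp only [ofModule'_mkQ]
    induction x using MonoidAlgebra.induction_linear with
    | zero => exact ⟨0, zero_mem _, fun g => by simp⟩
    | add x y hx hy =>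
      obtain ⟨⟨a, ha, hax⟩, b, hb, hby⟩ := And.intro hx hy
      exact ⟨a + b, add_mem ha hb, fun g => by
        rw [mul_add, map_add, map_add, hax, hby, Pi.add_apply]⟩
    | single h r =>
      refine ⟨r • (f ∘ LinearMap.mulRight F h.val),
        Submodule.smul_mem _ _ (comp_mem_homogeneousFun hf _), fun g => ?_⟩
      have hsingle : MonoidAlgebra.single g 1 * MonoidAlgebra.single h r =
          r • MonoidAlgebra.single (g * h) (1 : F) := by simp
      rw [hsingle, LinearMap.map_smul_of_tower, map_smul, hfφ]
      rfl

variable {wt : Fin n → ℤ}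

lemma isHighestWeightVec_mkQ_one (hJ : ∀ b : GL (Fin n) F, b.val.BlockTriangular id →
      MonoidAlgebra.single b (1 : F) - MonoidAlgebra.single 1 (borelChar wt b) ∈ J) :
    IsHighestWeightVec
      (Representation.ofModule' (k := F) (G := GL (Fin n) F) (F[GL (Fin n) F] ⧸ J)) wt
      (J.mkQ 1) := by
  intro b hb
  have hsmul : MonoidAlgebra.single 1 (borelChar wt b) =
      borelChar wt b • (1 : F[GL (Fin n) F]) := by
    simp [MonoidAlgebra.one_def]
  rw [ofModule'_mkQ, mul_one, ← LinearMap.map_smul_of_tower, ← sub_eq_zero, ← map_sub, ← hsmul]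
  exact (Submodule.Quotient.mk_eq_zero J).2 (hJ b hb)

lemma isHighestWeightVec_weylVec (wt : Fin n → ℤ) :
    IsHighestWeightVec (weyl F wt).ρ wt (weylVec wt) :=
  isHighestWeightVec_mkQ_one fun b hb => Submodule.mem_sInf.2 fun _ hJ => hJ.1 b hb

theorem isHomogeneousRep_weyl [Infinite F] (hwt : ∀ i, 0 ≤ wt i) (hd : ∑ i, wt i = d) :
    IsHomogeneousRep d (weyl F wt).ρ := by
  refine isHomogeneousRep_of_schurEval_ker_le fun x hx => Submodule.mem_sInf.2 fun J hJ =>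
    schurEval_ker_le (fun φ => ?_) hx
  obtain ⟨f, hf, hfφ⟩ :=
    (isHighestWeightVec_mkQ_one hJ.1).exists_homogeneousFun hJ.2 hwt hd φ
  exact ⟨f, hf, fun g => by rw [← hfφ, ofModule'_mkQ, mul_one]⟩

theorem isHomogeneousRep_irr (h : IsHomogeneousRep d (weyl F wt).ρ) :
    IsHomogeneousRep d (irr F wt).ρ :=
  h.of_surjective (f := (weylRad wt).mkQ.restrictScalars F)
    (weylRad wt).mkQ_surjective fun _ _ => rfl

end Weyl

/-! ### The right adjoint of truncation -/

section Coinduction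

variable {F : Type*} [Field F] [Infinite F] {n d : ℕ} {V : Type*} [AddCommGroup V] [Module F V]
  {ρ : Representation F (GL (Fin n) F) V}

/-- The homogeneous representation of `GL_m` coinduced from a homogeneous representation `ρ` of
`GL_n`: the homogeneous polynomial maps `f` on the space of `n × m` matrices that are equivariant
for the left action of the monoid of `n × n` matrices. -/
def coind (hρ : IsHomogeneousRep d ρ) (m : ℕ) : Submodule F (Matrix (Fin n) (Fin m) F → V) where
  carrier := {f | f ∈ homogeneousMap F (Matrix (Fin n) (Fin m) F) V d ∧
    ∀ a x, f (a * x) = hρ.mat a (f x)}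
  add_mem' hf hg := ⟨add_mem hf.1 hg.1, fun a x => by simp [hf.2, hg.2]⟩
  zero_mem' := ⟨zero_mem _, fun a x => by simp⟩
  smul_mem' c f hf := ⟨Submodule.smul_mem _ c hf.1, fun a x => by simp [hf.2]⟩

/-- The action of `GL_m` on `coind` by right translations. -/
def coindRep (hρ : IsHomogeneousRep d ρ) (m : ℕ) :
    Representation F (GL (Fin m) F) (coind hρ m) where
  toFun g :=
    { toFun f := ⟨fun x => f.1 (x * g.val),
        comp_linearMap_mem_homogeneousMap f.2.1 (mulRightLinearMap (Fin n) F g.val),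
        fun a x => by simp only [Matrix.mul_assoc, f.2.2]⟩
      map_add' _ _ := rfl
      map_smul' _ _ := rfl }
  map_one' := by ext f x; simp
  map_mul' g h := by ext f x; simp [Matrix.mul_assoc]

variable (hρ : IsHomogeneousRep d ρ) {m : ℕ}

/-- Evaluation of the elements of `coind` at an `n × m` matrix. -/
def coindEval (x : Matrix (Fin n) (Fin m) F) : coind hρ m →ₗ[F] V :=
  LinearMap.proj x ∘ₗ (coind hρ m).subtype

lemma coindEval_coindRep (x : Matrix (Fin n) (Fin m) F) (g : GL (Fin m) F) (f : coind hρ m) :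
    coindEval hρ x (coindRep hρ m g f) = coindEval hρ (x * g.val) f := rfl

variable {hρ} in
lemma coind_ext {f f' : coind hρ m} (h : ∀ x, coindEval hρ x f = coindEval hρ x f') : f = f' :=
  Subtype.ext (funext h)

lemma coindEval_mul (a : Matrix (Fin n) (Fin n) F) (x : Matrix (Fin n) (Fin m) F)
    (f : coind hρ m) : coindEval hρ (a * x) f = hρ.mat a (coindEval hρ x f) :=
  f.2.2 a x

theorem isHomogeneousRep_coindRep (m : ℕ) : IsHomogeneousRep d (coindRep hρ m) := by
  have := hρ.finite
  have : Module.Finite F (coind hρ m) :=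
    Module.Finite.of_injective (Submodule.inclusion fun f hf => hf.1)
      (Submodule.inclusion_injective (p' := homogeneousMap F (Matrix (Fin n) (Fin m) F) V d) _)
  refine .of_separating (S := {ψ | ∃ φ x, ψ = φ ∘ₗ coindEval hρ x}) (fun f hf => ?_) ?_
  · refine coind_ext fun x => ?_
    rw [map_zero, ← Module.forall_dual_apply_eq_zero_iff F]
    exact fun φ => hf _ ⟨φ, x, rfl⟩
  · rintro _ ⟨φ, x, rfl⟩ f
    exact ⟨_, comp_linearMap_mem_homogeneousMap f.2.1 (mulLeftLinearMap (Fin m) F x) φ,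
      fun g => rfl⟩

lemma coindEval_mat (y : Matrix (Fin m) (Fin m) F) (x : Matrix (Fin n) (Fin m) F)
    (f : coind hρ m) :
    coindEval hρ x ((isHomogeneousRep_coindRep hρ m).mat y f) = coindEval hρ (x * y) f :=
  congrFun (homogeneousMap_ext_GL
    (linearMap_comp_mem_homogeneousMap
      ((isHomogeneousRep_coindRep hρ m).mat_mem_homogeneousMap f) (coindEval hρ x))
    (comp_linearMap_mem_homogeneousMap f.2.1 (mulLeftLinearMap (Fin m) F x)) fun g => by
      rw [Function.comp_apply, IsHomogeneousRep.mat_val, coindEval_coindRep]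
      rfl) y

end Coinduction

section Truncation

variable {F : Type*} [Field F] [Infinite F] {n d : ℕ} {V : Type*} [AddCommGroup V] [Module F V]

section Counit

variable {ρ : Representation F (GL (Fin n) F) V} (hρ : IsHomogeneousRep d ρ)

/-- The map `x ↦ (x * initIncl) w`, whose value at `initProj` is `w`. -/
def coindElt (w : V) : coind hρ (n + 1) :=
  ⟨fun x => hρ.mat (x * initIncl F n) w,
    comp_linearMap_mem_homogeneousMap (hρ.mat_mem_homogeneousMap w)
      (mulRightLinearMap (Fin n) F (initIncl F n)),
    fun a x => by simp only [Matrix.mul_assoc, map_mul, Module.End.mul_apply]⟩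

lemma coindEval_coindElt (x : Matrix (Fin n) (Fin (n + 1)) F) (w : V) :
    coindEval hρ x (coindElt hρ w) = hρ.mat (x * initIncl F n) w := rfl

lemma coindEval_initProj_coindElt (w : V) :
    coindEval hρ (initProj F n) (coindElt hρ w) = w := by
  rw [coindEval_coindElt, initProj_mul_initIncl, map_one, Module.End.one_apply]

lemma coindElt_mem_invariants (w : V) : coindElt hρ w ∈ invariants (coindRep hρ (n + 1)) := by
  refine fun s => coind_ext fun x => ?_
  rw [coindEval_coindRep, coindEval_coindElt, Matrix.mul_assoc, subtorus_mul_initIncl,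
    coindEval_coindElt]

lemma coindElt_coindEval_initProj {f : coind hρ (n + 1)}
    (hf : f ∈ invariants (coindRep hρ (n + 1))) :
    coindElt hρ (coindEval hρ (initProj F n) f) = f := by
  refine coind_ext fun x => ?_
  rw [coindEval_coindElt, ← coindEval_mul, Matrix.mul_assoc, ← extendZero_one, ← coindEval_mat,
    (isHomogeneousRep_coindRep hρ (n + 1)).mem_invariants_iff.1 hf]

/-- Evaluation at `initProj`, as an isomorphism from the truncation of the coinduced
representation: the counit of the adjunction between truncation and coinduction. -/
def coindInvariantsEquiv : invariants (coindRep hρ (n + 1)) ≃ₗ[F] V where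
  toLinearMap := coindEval hρ (initProj F n) ∘ₗ (invariants (coindRep hρ (n + 1))).subtype
  invFun w := ⟨coindElt hρ w, coindElt_mem_invariants hρ w⟩
  left_inv f := Subtype.ext (coindElt_coindEval_initProj hρ f.2)
  right_inv := coindEval_initProj_coindElt hρ

lemma coindInvariantsEquiv_invRep (g : GL (Fin n) F) (f : invariants (coindRep hρ (n + 1))) :
    coindInvariantsEquiv hρ (invRep (coindRep hρ (n + 1)) g f) =
      ρ g (coindInvariantsEquiv hρ f) := by
  change coindEval hρ (initProj F n) (coindRep hρ (n + 1) (embed g) f) =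
    ρ g (coindEval hρ (initProj F n) f)
  rw [coindEval_coindRep, initProj_mul_embed, coindEval_mul, hρ.mat_val]

end Counit

section Unit

variable {ρ : Representation F (GL (Fin (n + 1)) F) V} (hρ : IsHomogeneousRep d ρ)

lemma mat_initIncl_mul_mem_invariants (x : Matrix (Fin n) (Fin (n + 1)) F) (v : V) :
    hρ.mat (initIncl F n * x) v ∈ invariants ρ := by
  rw [hρ.mem_invariants_iff, ← Module.End.mul_apply, ← map_mul, extendZero_one, Matrix.mul_assoc,
    initProj_mul_initIncl_mul]

/-- The unit `v ↦ (x ↦ (initIncl * x) v)` of the adjunction between truncation and coinduction. -/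
def toCoindInvariants : V →ₗ[F] coind hρ.invRep (n + 1) where
  toFun v := ⟨fun x => ⟨hρ.mat (initIncl F n * x) v, mat_initIncl_mul_mem_invariants hρ x v⟩,
    fun φ => by
      obtain ⟨ψ, rfl⟩ := LinearMap.exists_extend φ
      exact comp_linearMap_mem_homogeneousMap (hρ.mat_mem_homogeneousMap v)
        (mulLeftLinearMap (Fin (n + 1)) F (initIncl F n)) ψ,
    fun a x => Subtype.ext <| by
      rw [hρ.coe_invRep_mat, ← Module.End.mul_apply, ← map_mul, extendZero_apply,
        Matrix.mul_assoc, initProj_mul_initIncl_mul, Matrix.mul_assoc]⟩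
  map_add' v w := coind_ext fun x => Subtype.ext (map_add (hρ.mat (initIncl F n * x)) v w)
  map_smul' c v := coind_ext fun x => Subtype.ext (map_smul (hρ.mat (initIncl F n * x)) c v)

lemma coindEval_toCoindInvariants (x : Matrix (Fin n) (Fin (n + 1)) F) (v : V) :
    (coindEval hρ.invRep x (toCoindInvariants hρ v) : V) = hρ.mat (initIncl F n * x) v := rfl

lemma toCoindInvariants_apply (g : GL (Fin (n + 1)) F) (v : V) :
    toCoindInvariants hρ (ρ g v) = coindRep hρ.invRep (n + 1) g (toCoindInvariants hρ v) := by
  refine coind_ext fun x => Subtype.ext ?_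
  rw [coindEval_coindRep, coindEval_toCoindInvariants, coindEval_toCoindInvariants,
    ← Matrix.mul_assoc, map_mul, Module.End.mul_apply, hρ.mat_val]

end Unit

end Truncation

section Adjunction

variable {F : Type u} [Field F] [Infinite F] {n d : ℕ}

lemma isHomogeneousRep_obj (M : PolRep F n d) : IsHomogeneousRep d M.obj.ρ :=
  M.property.isHomogeneousRep

lemma hom_mat_apply {M N : PolRep F n d} (f : M ⟶ N) (x : Matrix (Fin n) (Fin n) F)
    (v : M.obj.V) : f.hom.hom ((isHomogeneousRep_obj M).mat x v) =
      (isHomogeneousRep_obj N).mat x (f.hom.hom v) :=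
  (isHomogeneousRep_obj M).map_mat (isHomogeneousRep_obj N) (f := f.hom.hom.toLinearMap)
    (fun g v => Rep.hom_comm_apply f.hom g v) x v

/-- The postcomposition of the elements of `coind` with a morphism of representations. -/
def coindMap {V W : PolRep F n d} (f : V ⟶ W) (m : ℕ) :
    coind (isHomogeneousRep_obj V) m →ₗ[F] coind (isHomogeneousRep_obj W) m where
  toFun h := ⟨fun x => f.hom.hom (h.1 x),
    linearMap_comp_mem_homogeneousMap h.2.1 f.hom.hom.toLinearMap,
    fun a x => by simp only [h.2.2, hom_mat_apply]⟩
  map_add' h h' := coind_ext fun x => map_add f.hom.hom (h.1 x) (h'.1 x)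
  map_smul' c h := coind_ext fun x => map_smul f.hom.hom c (h.1 x)

variable (F n d) in
/-- Coinduction from `GL_n` to `GL_m`, as a functor between the categories of polynomial
representations. -/
def coindFunctor (m : ℕ) : PolRep F n d ⥤ PolRep F m d where
  obj V := ⟨Rep.of (coindRep (isHomogeneousRep_obj V) m),
    (isHomogeneousRep_coindRep (isHomogeneousRep_obj V) m).isPolynomial⟩
  map f := ObjectProperty.homMk (Rep.ofHom ⟨coindMap f m, fun g => rfl⟩)

variable (F n d) in
/-- The counit of the adjunction between truncation and coinduction. -/
def coindCounit : coindFunctor F n d (n + 1) ⋙ tau F n d ≅ 𝟭 (PolRep F n d) :=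
  NatIso.ofComponents (fun V => (polProp F n d).isoMk (Rep.mkIso
    (.mk (coindInvariantsEquiv (isHomogeneousRep_obj V)) fun g =>
      LinearMap.ext (coindInvariantsEquiv_invRep (isHomogeneousRep_obj V) g)))) fun _ => rfl

variable (F n d) in
/-- The unit of the adjunction between truncation and coinduction. -/
def coindUnit : 𝟭 (PolRep F (n + 1) d) ⟶ tau F n d ⋙ coindFunctor F n d (n + 1) where
  app M := ObjectProperty.homMk (Rep.ofHom ⟨toCoindInvariants (isHomogeneousRep_obj M), fun g =>
    LinearMap.ext (toCoindInvariants_apply (isHomogeneousRep_obj M) g)⟩)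
  naturality M N f := by
    refine ObjectProperty.hom_ext _ (Rep.hom_ext (Representation.IntertwiningMap.ext
      (LinearMap.ext fun v => coind_ext fun x => Subtype.ext ?_)))
    exact (hom_mat_apply f (initIncl F n * x) v).symm

variable (F n d) in
/-- Truncation is left adjoint to coinduction. -/
def tauAdjunction : tau F n d ⊣ coindFunctor F n d (n + 1) where
  unit := coindUnit F n d
  counit := (coindCounit F n d).hom
  left_triangle_components M := by
    refine ObjectProperty.hom_ext _ (Rep.hom_ext (Representation.IntertwiningMap.ext
      (LinearMap.ext fun v => Subtype.ext ?_)))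
    change (isHomogeneousRep_obj M).mat (initIncl F n * initProj F n) v.1 = v.1
    rw [← extendZero_one, (isHomogeneousRep_obj M).mem_invariants_iff.1 v.2]
  right_triangle_components V := by
    let hV := isHomogeneousRep_obj V
    refine ObjectProperty.hom_ext _ (Rep.hom_ext (Representation.IntertwiningMap.ext
      (LinearMap.ext fun f => coind_ext fun x => ?_)))
    exact (coindEval_mat hV (initIncl F n * x) (initProj F n) f).trans
      (congrArg (coindEval hV · f) (initProj_mul_initIncl_mul x))

end Adjunction

/-! ### Exactness -/

section Retract

variable {C D J : Type*} [Category* C] [Category* D] [Category* J] {G H : C ⥤ D}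

lemma preservesLimitsOfShape_of_retract (h : Retract G H) [PreservesLimitsOfShape J H] :
    PreservesLimitsOfShape J G where
  preservesLimit {K} :=
    { preserves {c} hc := by
        have hH := isLimitOfPreserves H hc
        let lift (s : Cone (K ⋙ G)) : s.pt ⟶ H.obj c.pt :=
          hH.lift ((Cone.postcompose (Functor.whiskerLeft K h.i)).obj s)
        have lift_map (s : Cone (K ⋙ G)) (j : J) :
            lift s ≫ H.map (c.π.app j) = s.π.app j ≫ h.i.app (K.obj j) :=
          hH.fac ((Cone.postcompose (Functor.whiskerLeft K h.i)).obj s) j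
        have retract_app (X : C) : h.i.app X ≫ h.r.app X = 𝟙 (G.obj X) :=
          NatTrans.congr_app h.retract X
        refine ⟨{ lift s := lift s ≫ h.r.app c.pt, fac s j := ?_, uniq s m hm := ?_ }⟩
        · change (lift s ≫ h.r.app c.pt) ≫ G.map (c.π.app j) = s.π.app j
          rw [Category.assoc, ← h.r.naturality, ← Category.assoc, lift_map, Category.assoc]
          exact (congrArg _ (retract_app _)).trans (Category.comp_id _)
        · have : m ≫ h.i.app c.pt = lift s := hH.hom_ext fun j => by
            change (m ≫ h.i.app c.pt) ≫ H.map (c.π.app j) = lift s ≫ H.map (c.π.app j)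
            rw [lift_map, Category.assoc, ← h.i.naturality, ← Category.assoc]
            exact congrArg (· ≫ h.i.app (K.obj j)) (hm j)
          rw [← this, Category.assoc, retract_app]
          exact (Category.comp_id m).symm }

end Retract

section Exactness

variable {F : Type u} [Field F] {n d : ℕ}

lemma IsHomogeneousRep.of_jointly_injective {V J : Type*} [AddCommGroup V] [Module F V]
    [Finite J] {W : J → Type*} [∀ j, AddCommGroup (W j)] [∀ j, Module F (W j)]
    {ρ : Representation F (GL (Fin n) F) V} {σ : ∀ j, Representation F (GL (Fin n) F) (W j)}
    (hσ : ∀ j, IsHomogeneousRep d (σ j)) {f : ∀ j, V →ₗ[F] W j}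
    (hf : ∀ j g v, f j (ρ g v) = σ j g (f j v)) (hinj : ∀ v, (∀ j, f j v = 0) → v = 0) :
    IsHomogeneousRep d ρ := by
  have := fun j => (hσ j).finite
  have : Module.Finite F V := Module.Finite.of_injective (LinearMap.pi f)
    ((injective_iff_map_eq_zero _).2 fun v hv => hinj v fun j => congrFun hv j)
  refine .of_separating (S := {φ | ∃ (j : J) (ψ : Module.Dual F (W j)), φ = ψ ∘ₗ f j})
    (fun v hv => hinj v fun j => ?_) ?_
  · exact (Module.forall_dual_apply_eq_zero_iff F _).1 fun ψ => hv _ ⟨j, ψ, rfl⟩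
  · rintro _ ⟨j, ψ, rfl⟩ v
    obtain ⟨a, ha, hag⟩ := (hσ j).coeff ψ (f j v)
    exact ⟨a, ha, fun g => by rw [LinearMap.comp_apply, hf, hag]⟩

variable [Infinite F]

instance (J : Type) [SmallCategory J] :
    PreservesLimitsOfShape J (forget₂ (Rep.{u} F (GL (Fin n) F)) (ModuleCat.{u} F)) :=
  have := preservesLimitsOfSize_shrink.{0, u, 0, u}
    (forget₂ (Rep.{u} F (GL (Fin n) F)) (ModuleCat.{u} F))
  inferInstance

instance (J : Type) [SmallCategory J] [FinCategory J] :
    (polProp F n d).IsClosedUnderLimitsOfShape J where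
  limitsOfShape_le := by
    rintro X ⟨p⟩
    refine IsHomogeneousRep.isPolynomial (.of_jointly_injective
      (fun j => (p.prop_diag_obj j).isHomogeneousRep) (f := fun j => (p.π.app j).hom.toLinearMap)
      (fun j g v => Rep.hom_comm_apply (p.π.app j) g v) fun v hv => ?_)
    exact Concrete.isLimit_ext _ (isLimitOfPreserves
      (forget₂ (Rep.{u} F (GL (Fin n) F)) (ModuleCat.{u} F)) p.isLimit) v 0 fun j =>
        (hv j).trans (map_zero (p.π.app j).hom).symm

variable (F n d) in
/-- The underlying vector space of a polynomial representation. -/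
abbrev underlying : PolRep F n d ⥤ ModuleCat.{u} F :=
  (polProp F n d).ι ⋙ forget₂ (Rep.{u} F (GL (Fin n) F)) (ModuleCat.{u} F)

variable (F n d) in
/-- On underlying vector spaces, truncation is a direct summand of the identity functor: the
idempotent matrix `diag(1, …, 1, 0)` projects a representation onto its truncation. -/
def tauRetract : Retract (tau F n d ⋙ underlying F n d) (underlying F (n + 1) d) where
  i := { app M := ModuleCat.ofHom (invariants M.obj.ρ).subtype }
  r :=
    { app M := ModuleCat.ofHom (((isHomogeneousRep_obj M).mat (extendZero F n 1)).codRestrict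
        (invariants M.obj.ρ) ((isHomogeneousRep_obj M).mat_extendZero_mem_invariants 1))
      naturality M N f := ModuleCat.hom_ext (LinearMap.ext fun v =>
        Subtype.ext (hom_mat_apply f (extendZero F n 1) v).symm) }
  retract := by
    ext M v
    exact Subtype.ext ((isHomogeneousRep_obj M).mem_invariants_iff.1 v.2)

theorem preservesFiniteLimits_tau : PreservesFiniteLimits (tau F n d) where
  preservesFiniteLimits J _ _ := by
    have : ReflectsLimitsOfSize.{0, 0} (forget₂ (Rep.{u} F (GL (Fin n) F)) (ModuleCat.{u} F)) :=
      reflectsLimitsOfSize_shrink.{0, u, 0, u} _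
    have : HasLimitsOfSize.{0, 0} (Rep.{u} F (GL (Fin (n + 1)) F)) :=
      hasLimitsOfSizeShrink.{0, 0, u, u} _
    have := preservesLimitsOfShape_of_retract (J := J) (tauRetract F n d)
    exact preservesLimitsOfShape_of_reflects_of_preserves (tau F n d) (underlying F n d)

theorem preservesFiniteColimits_tau : PreservesFiniteColimits (tau F n d) :=
  have := (tauAdjunction F n d).isLeftAdjoint
  inferInstance

end Exactness

/-! ### Truncation of Weyl modules -/

section HighestWeightTruncation

variable {F : Type*} [Field F] {n d : ℕ} {V : Type*} [AddCommGroup V] [Module F V]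
  {wt : Fin n → ℤ}

lemma borelChar_snoc_zero (wt : Fin n → ℤ) {a : GL (Fin n) F} {b : GL (Fin (n + 1)) F}
    (h : ∀ i, b.val i.castSucc i.castSucc = a.val i i) :
    borelChar (Fin.snoc wt 0 : Fin (n + 1) → ℤ) b = borelChar wt a := by
  simp [borelChar, Fin.prod_univ_castSucc, h]

lemma exists_GL_mul_initIncl_eq {b : GL (Fin (n + 1)) F} (hb : b.val.BlockTriangular id) :
    ∃ a : GL (Fin n) F, a.val.BlockTriangular id ∧
      (∀ i, b.val i.castSucc i.castSucc = a.val i i) ∧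
      b.val * initIncl F n = initIncl F n * a.val := by
  let a : Matrix (Fin n) (Fin n) F := b.val.submatrix Fin.castSucc Fin.castSucc
  have ha : a.BlockTriangular id := fun i j hij => hb (Fin.castSucc_lt_castSucc_iff.2 hij)
  have hdet : a.det ≠ 0 := by
    rw [Matrix.det_of_isUpperTriangular ha]
    exact Finset.prod_ne_zero_iff.2 fun i _ => apply_self_ne_zero_of_blockTriangular hb i.castSucc
  refine ⟨.mkOfDetNeZero a hdet, ha, fun i => rfl, ?_⟩
  change b.val * initIncl F n = initIncl F n * a
  ext i j
  refine Fin.lastCases ?_ (fun i => ?_) i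
  · have hbj : b.val (Fin.last n) j.castSucc = 0 := hb (Fin.castSucc_lt_last j)
    simp [Matrix.mul_apply, Fin.sum_univ_castSucc, hbj]
  · simp [Matrix.mul_apply, Fin.sum_univ_castSucc, a]

lemma blockTriangular_embed {b : GL (Fin n) F} (hb : b.val.BlockTriangular id) :
    (embed b).val.BlockTriangular id := by
  intro i j hij
  induction i using Fin.lastCases with
  | last =>
    obtain ⟨j, rfl⟩ := Fin.exists_castSucc_eq.2 hij.ne
    exact embed_last_castSucc b j
  | cast i =>
    obtain ⟨j, rfl⟩ := Fin.exists_castSucc_eq.2 (hij.trans (Fin.castSucc_lt_last i)).ne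
    rw [embed_castSucc]
    exact hb (Fin.castSucc_lt_castSucc_iff.1 hij)

lemma IsHighestWeightVec.coindElt [Infinite F] {ρ : Representation F (GL (Fin n) F) V}
    (hρ : IsHomogeneousRep d ρ) {w : V} (hw : IsHighestWeightVec ρ wt w) :
    IsHighestWeightVec (coindRep hρ (n + 1)) (Fin.snoc wt 0) (coindElt hρ w) := by
  intro b hb
  obtain ⟨a, ha, hab, hmul⟩ := exists_GL_mul_initIncl_eq hb
  refine coind_ext fun x => ?_
  rw [coindEval_coindRep, map_smul, coindEval_coindElt, coindEval_coindElt, Matrix.mul_assoc,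
    hmul, ← Matrix.mul_assoc, map_mul, Module.End.mul_apply, hρ.mat_val, hw a ha, map_smul,
    borelChar_snoc_zero wt hab]

variable {ρ : Representation F (GL (Fin (n + 1)) F) V} {v : V}

lemma IsHighestWeightVec.mem_invariants (hv : IsHighestWeightVec ρ (Fin.snoc wt 0) v) :
    v ∈ invariants ρ := by
  intro s
  rw [subtorus_eq_diag_mulSingle, hv _ (Matrix.blockTriangular_diagonal _), borelChar_diag,
    torusChar_mulSingle, Fin.snoc_last, zpow_zero, one_smul]

lemma IsHighestWeightVec.invRep (hv : IsHighestWeightVec ρ (Fin.snoc wt 0) v) :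
    IsHighestWeightVec (invRep ρ) wt ⟨v, hv.mem_invariants⟩ := by
  intro b hb
  refine Subtype.ext ?_
  rw [invRep_coe, hv _ (blockTriangular_embed hb), borelChar_snoc_zero wt fun i =>
    embed_castSucc b i i]
  rfl

end HighestWeightTruncation

section WeylTruncation

variable {F : Type u} [Field F] {n d : ℕ} {wt : Fin n → ℤ}

lemma exists_hom_weyl (h : polProp F n d (weyl F wt)) {M : PolRep F n d} {m : M.obj.V}
    (hm : IsHighestWeightVec M.obj.ρ wt m) :
    ∃ f : (⟨weyl F wt, h⟩ : PolRep F n d) ⟶ M, f.hom.hom (weylVec wt) = m := by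
  obtain ⟨f, hf, -⟩ := weyl_universal wt M.obj M.property.rational m hm
  exact ⟨ObjectProperty.homMk f, hf⟩

lemma weyl_hom_ext {h : polProp F n d (weyl F wt)} {M : PolRep F n d}
    {f f' : (⟨weyl F wt, h⟩ : PolRep F n d) ⟶ M}
    (hff' : f.hom.hom (weylVec wt) = f'.hom.hom (weylVec wt)) : f = f' := by
  refine ObjectProperty.hom_ext _ ((weyl_universal wt M.obj M.property.rational _ ?_).unique
    hff' rfl)
  intro b hb
  rw [← Rep.hom_comm_apply, isHighestWeightVec_weylVec wt b hb, map_smul]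

/-- The homomorphism `Δ(λ) ⟶ τ Δ(λ,0)` is given by the universal property of `Δ(λ)`, and its
inverse is adjoint to the homomorphism `Δ(λ,0) ⟶ coind Δ(λ)` given by that of `Δ(λ,0)`. -/
theorem exists_weyl_iso_tau [Infinite F] (h : polProp F n d (weyl F wt))
    (h' : polProp F (n + 1) d (weyl F (Fin.snoc wt 0 : Fin (n + 1) → ℤ))) :
    ∃ e : (⟨weyl F wt, h⟩ : PolRep F n d) ≅ (tau F n d).obj ⟨_, h'⟩,
      e.hom.hom.hom (weylVec wt) = (⟨weylVec (Fin.snoc wt 0),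
        (isHighestWeightVec_weylVec _).mem_invariants⟩ : invariants (weyl F _).ρ) := by
  let Δ : PolRep F n d := ⟨_, h⟩
  let Δ' : PolRep F (n + 1) d := ⟨_, h'⟩
  let adj := (tauAdjunction F n d).homEquiv Δ' Δ
  obtain ⟨θ, hθ⟩ := exists_hom_weyl h (M := (tau F n d).obj Δ')
    (isHighestWeightVec_weylVec (Fin.snoc wt 0)).invRep
  obtain ⟨ψ, hψ⟩ := exists_hom_weyl h' (M := (coindFunctor F n d (n + 1)).obj Δ)
    ((isHighestWeightVec_weylVec wt).coindElt (isHomogeneousRep_obj Δ))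
  refine ⟨⟨θ, adj.symm ψ, weyl_hom_ext ?_, ?_⟩, hθ⟩
  · change coindEval (isHomogeneousRep_obj Δ) (initProj F n)
      (ψ.hom.hom (θ.hom.hom (weylVec wt)).1) = weylVec wt
    rw [hθ, hψ, coindEval_initProj_coindElt]
  · rw [← Adjunction.homEquiv_naturality_right_symm, Equiv.symm_apply_eq, Adjunction.homEquiv_id]
    refine weyl_hom_ext (coind_ext fun x => Subtype.ext ?_)
    let hΔ' := isHomogeneousRep_obj Δ'
    change (θ.hom.hom (coindEval (isHomogeneousRep_obj Δ) x (ψ.hom.hom (weylVec _)))).1 =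
      hΔ'.mat (initIncl F n * x) (weylVec (Fin.snoc wt 0))
    rw [hψ, coindEval_coindElt, hom_mat_apply, hθ]
    refine (hΔ'.coe_invRep_mat _ _).trans ?_
    rw [extendZero_apply, Matrix.mul_assoc, Matrix.mul_assoc x, ← extendZero_one,
      ← Matrix.mul_assoc, map_mul, Module.End.mul_apply]
    exact congrArg _ (hΔ'.mem_invariants_iff.1 (isHighestWeightVec_weylVec _).mem_invariants)

end WeylTruncation

/-! ### Truncation of irreducible modules -/

lemma nonempty_equiv_of_ker_eq {k G V W W' : Type*} [CommRing k] [Monoid G] [AddCommGroup V]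
    [Module k V] [AddCommGroup W] [Module k W] [AddCommGroup W'] [Module k W']
    {ρ : Representation k G V} {σ : Representation k G W} {σ' : Representation k G W'}
    {p : ρ.IntertwiningMap σ} {p' : ρ.IntertwiningMap σ'} (hp : Function.Surjective p)
    (hp' : Function.Surjective p') (h : p.toLinearMap.ker = p'.toLinearMap.ker) :
    Nonempty (σ.Equiv σ') := by
  let q := (p.toLinearMap.quotKerEquivOfSurjective hp).symm ≪≫ₗ Submodule.quotEquivOfEq _ _ h ≪≫ₗ
    p'.toLinearMap.quotKerEquivOfSurjective hp'
  have hq (v : V) : q (p v) = p' v :=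
    congrArg
      (fun v => p'.toLinearMap.quotKerEquivOfSurjective hp' (Submodule.quotEquivOfEq _ _ h v))
      (LinearMap.quotKerEquivOfSurjective_symm_apply p.toLinearMap hp v)
  refine ⟨.mk q fun g => LinearMap.ext fun w => ?_⟩
  obtain ⟨v, rfl⟩ := hp w
  change q (σ g (p v)) = σ' g (q (p v))
  rw [← p.isIntertwining, hq, hq, p'.isIntertwining]

lemma IsHomogeneousRep.exists_mem_invariants_apply_eq {F V W : Type*} [Field F] [Infinite F]
    {n d : ℕ} [AddCommGroup V] [Module F V] [AddCommGroup W] [Module F W]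
    {ρ : Representation F (GL (Fin (n + 1)) F) V} {σ : Representation F (GL (Fin (n + 1)) F) W}
    (hρ : IsHomogeneousRep d ρ) {f : V →ₗ[F] W} (hf : Function.Surjective f)
    (hfρ : ∀ g v, f (ρ g v) = σ g (f v)) {w : W} (hw : w ∈ invariants σ) :
    ∃ v ∈ invariants ρ, f v = w := by
  have hσ := hρ.of_surjective hf hfρ
  obtain ⟨v, rfl⟩ := hf w
  exact ⟨_, hρ.mat_extendZero_mem_invariants 1 v,
    (hρ.map_mat hσ hfρ _ v).trans (hσ.mem_invariants_iff.1 hw)⟩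

section Submodules

variable {F : Type*} [Field F] {n d : ℕ}
  {A : Type*} [AddCommGroup A] [Module F A] [Module F[GL (Fin n) F] A]
  [IsScalarTower F F[GL (Fin n) F] A]
  {A' : Type*} [AddCommGroup A'] [Module F A'] [Module F[GL (Fin (n + 1)) F] A']
  [IsScalarTower F F[GL (Fin (n + 1)) F] A']
  (e : (Representation.ofModule' (k := F) (G := GL (Fin n) F) A).Equiv
    (invRep (Representation.ofModule' (k := F) (G := GL (Fin (n + 1)) F) A')))

/-- The truncation `N' ∩ A'^S` of a submodule `N'` of `A'`, seen as a submodule of a module `A`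
identified with `A'^S`. -/
def truncSubmodule (N' : Submodule F[GL (Fin (n + 1)) F] A') : Submodule F[GL (Fin n) F] A :=
  MonoidAlgebra.submoduleOfSMulMem
    ((N'.restrictScalars F).comap ((invariants _).subtype ∘ₗ e.toLinearMap)) fun g x hx => by
      have hgx := congrArg Subtype.val (e.toIntertwiningMap.isIntertwining _ _ g x)
      change (e (Representation.ofModule' (k := F) A g x) : A') ∈ N'
      exact hgx ▸ N'.smul_mem (MonoidAlgebra.single (embed g) 1) hx

lemma mem_truncSubmodule {N' : Submodule F[GL (Fin (n + 1)) F] A'} {x : A} :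
    x ∈ truncSubmodule e N' ↔ (e x : A') ∈ N' := Iff.rfl

variable [Infinite F]
  (h' : IsHomogeneousRep d (Representation.ofModule' (k := F) (G := GL (Fin (n + 1)) F) A'))

/-- The largest submodule of `A'` whose truncation is contained in `N`. -/
def extendSubmodule (N : Submodule F[GL (Fin n) F] A) : Submodule F[GL (Fin (n + 1)) F] A' :=
  MonoidAlgebra.submoduleOfSMulMem
    (⨅ g, ((N.restrictScalars F).map ((invariants _).subtype ∘ₗ e.toLinearMap)).comap
      (h'.mat (extendZero F n 1) * Representation.ofModule' A' g))
    fun g y hy => by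
      simp only [Submodule.mem_iInf, Submodule.mem_comap, Module.End.mul_apply] at hy ⊢
      intro g'
      have hgy := hy (g' * g)
      rwa [map_mul] at hgy

variable {e h'}

lemma mem_extendSubmodule {N : Submodule F[GL (Fin n) F] A} {y : A'} :
    y ∈ extendSubmodule e h' N ↔ ∀ g : GL (Fin (n + 1)) F, ∃ x ∈ N, (e x : A') =
      h'.mat (extendZero F n 1) (Representation.ofModule' (k := F) A' g y) :=
  Submodule.mem_iInf _

variable (e h')

lemma gc_truncSubmodule_extendSubmodule :
    GaloisConnection (truncSubmodule e) (extendSubmodule e h') := by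
  refine fun N' N => ⟨fun hN y hy => mem_extendSubmodule.2 fun g => ?_, fun hN x hx => ?_⟩
  · let z : invariants _ :=
      ⟨_, h'.mat_extendZero_mem_invariants 1 (Representation.ofModule' (k := F) A' g y)⟩
    have hz : (e (e.symm z) : A') = z := congrArg Subtype.val (e.apply_symm_apply z)
    refine ⟨e.symm z, hN ((mem_truncSubmodule e).2 ?_), hz⟩
    rw [hz]
    exact h'.mat_mem (K := N'.restrictScalars F) (fun g _ hv => N'.smul_mem (.single g 1) hv) _
      (N'.smul_mem (.single g 1) hy)
  · obtain ⟨x₀, hx₀, heq⟩ := mem_extendSubmodule.1 (hN hx) 1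
    rw [map_one (Representation.ofModule' A'), Module.End.one_apply] at heq
    replace heq := heq.trans (h'.mem_invariants_iff.1 (e x).2)
    rwa [← e.injective (Subtype.ext heq)]

lemma truncSubmodule_extendSubmodule (N : Submodule F[GL (Fin n) F] A) :
    truncSubmodule e (extendSubmodule e h' N) = N := by
  refine le_antisymm ((gc_truncSubmodule_extendSubmodule e h').l_u_le N) fun x hx => ?_
  have h : IsHomogeneousRep d (Representation.ofModule' (k := F) (G := GL (Fin n) F) A) :=
    h'.invRep.of_surjective (f := e.symm.toLinearMap) e.symm.surjective
      (e.symm.toIntertwiningMap.isIntertwining _ _)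
  refine (mem_truncSubmodule e).2 (mem_extendSubmodule.2 fun g => ?_)
  refine ⟨h.mat (initProj F n * g.val * initIncl F n) x, h.mat_mem (K := N.restrictScalars F)
    (fun g _ hv => N.smul_mem (.single g 1) hv) _ hx, ?_⟩
  have hmat := h.map_mat h'.invRep (f := e.toLinearMap)
    (e.toIntertwiningMap.isIntertwining _ _) (initProj F n * g.val * initIncl F n) x
  refine (congrArg Subtype.val hmat).trans ((h'.coe_invRep_mat _ _).trans ?_)
  have hmul : extendZero F n (initProj F n * g.val * initIncl F n) =
      extendZero F n 1 * (g.val * extendZero F n 1) := by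
    simp only [extendZero_apply, Matrix.mul_assoc, Matrix.one_mul]
  rw [hmul, map_mul, map_mul, Module.End.mul_apply, Module.End.mul_apply, h'.mat_val]
  exact congrArg (fun y => h'.mat _ (Representation.ofModule' A' g y))
    (h'.mem_invariants_iff.1 (e x).2)

/-- Truncation of submodules preserves suprema and is surjective, being a left adjoint with
section `extendSubmodule`. -/
lemma truncSubmodule_sSup
    (h' : IsHomogeneousRep d (Representation.ofModule' (k := F) (G := GL (Fin (n + 1)) F) A'))
    (v : A) :
    truncSubmodule e (sSup {N' | (e v : A') ∉ N'}) = sSup {N | v ∉ N} := by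
  rw [(gc_truncSubmodule_extendSubmodule e h').l_sSup]
  refine le_antisymm (iSup₂_le fun N' hN' => le_sSup hN') (sSup_le fun N hN => ?_)
  rw [← truncSubmodule_extendSubmodule e h' N] at hN ⊢
  exact le_iSup₂ (f := fun N' _ => truncSubmodule e N') (extendSubmodule e h' N) hN

lemma nonempty_quotient_equiv_invRep
    (h' : IsHomogeneousRep d (Representation.ofModule' (k := F) (G := GL (Fin (n + 1)) F) A'))
    {N : Submodule F[GL (Fin n) F] A} {N' : Submodule F[GL (Fin (n + 1)) F] A'}
    (hN : truncSubmodule e N' = N) :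
    Nonempty ((Representation.ofModule' (k := F) (G := GL (Fin n) F) (A ⧸ N)).Equiv
      (invRep (Representation.ofModule' (k := F) (G := GL (Fin (n + 1)) F) (A' ⧸ N')))) := by
  let p : (Representation.ofModule' (k := F) (G := GL (Fin n) F) A).IntertwiningMap
      (Representation.ofModule' (A ⧸ N)) :=
    ⟨N.mkQ.restrictScalars F, fun _ => rfl⟩
  let q : A' →ₗ[F] A' ⧸ N' := N'.mkQ.restrictScalars F
  have hq (g : GL (Fin (n + 1)) F) (y : A') :
      q (Representation.ofModule' (k := F) A' g y) =
        Representation.ofModule' (k := F) (A' ⧸ N') g (q y) := rfl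
  let r : (Representation.ofModule' (k := F) (G := GL (Fin n) F) A).IntertwiningMap
      (invRep (Representation.ofModule' (A' ⧸ N'))) :=
    { toLinearMap := q.restrict (fun y hy s => by rw [← hq, hy s]) ∘ₗ e.toLinearMap
      isIntertwining' g := LinearMap.ext fun x => Subtype.ext <|
        congrArg q (congrArg Subtype.val (e.toIntertwiningMap.isIntertwining _ _ g x)) }
  refine nonempty_equiv_of_ker_eq (p := p) (p' := r) N.mkQ_surjective (fun y => ?_) ?_
  · obtain ⟨z, hz, hzy⟩ := h'.exists_mem_invariants_apply_eq N'.mkQ_surjective hq y.2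
    exact ⟨e.symm ⟨z, hz⟩, Subtype.ext
      ((congrArg q (congrArg Subtype.val (e.apply_symm_apply ⟨z, hz⟩))).trans hzy)⟩
  · ext x
    rw [LinearMap.mem_ker, LinearMap.mem_ker, ← Subtype.val_inj]
    exact (Submodule.Quotient.mk_eq_zero N).trans
      (hN ▸ (Submodule.Quotient.mk_eq_zero N').symm)

end Submodules

section TauWeyl

variable {F : Type u} [Field F] [Infinite F] {n d : ℕ} {wt : Fin n → ℤ}

lemma isHomogeneousRep_weyl_snoc_zero (hwt : ∀ i, 0 ≤ wt i) (hd : ∑ i, wt i = d) :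
    IsHomogeneousRep d (weyl F (Fin.snoc wt 0 : Fin (n + 1) → ℤ)).ρ :=
  isHomogeneousRep_weyl (Fin.lastCases (by simp) (by simpa using hwt))
    (by simpa [Fin.sum_univ_castSucc] using hd)

theorem tau_weyl (hwt : ∀ i, 0 ≤ wt i) (hd : ∑ i, wt i = d) :
    ∃ (h : polProp F (n + 1) d (weyl F (Fin.snoc wt 0 : Fin (n + 1) → ℤ)))
      (h' : polProp F n d (weyl F wt)), Nonempty ((tau F n d).obj ⟨_, h⟩ ≅ ⟨_, h'⟩) := by
  have h := (isHomogeneousRep_weyl (F := F) hwt hd).isPolynomial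
  have h' := (isHomogeneousRep_weyl_snoc_zero (F := F) hwt hd).isPolynomial
  obtain ⟨e, -⟩ := exists_weyl_iso_tau h h'
  exact ⟨h', h, ⟨e.symm⟩⟩

theorem tau_irr (hwt : ∀ i, 0 ≤ wt i) (hd : ∑ i, wt i = d) :
    ∃ (h : polProp F (n + 1) d (irr F (Fin.snoc wt 0 : Fin (n + 1) → ℤ)))
      (h' : polProp F n d (irr F wt)), Nonempty ((tau F n d).obj ⟨_, h⟩ ≅ ⟨_, h'⟩) := by
  have h := isHomogeneousRep_weyl (F := F) hwt hd
  have h' := isHomogeneousRep_weyl_snoc_zero (F := F) hwt hd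
  obtain ⟨i, hi⟩ := exists_weyl_iso_tau h.isPolynomial h'.isPolynomial
  let e : (weyl F wt).ρ.Equiv (invRep (weyl F (Fin.snoc wt 0)).ρ) :=
    Representation.equivOfIso ((polProp F n d).ι.mapIso i)
  have he : (e (weylVec wt) : WeylMod F _) = weylVec (Fin.snoc wt 0) := congrArg Subtype.val hi
  have hrad : truncSubmodule e (weylRad (Fin.snoc wt 0)) = weylRad wt := by
    have := truncSubmodule_sSup e h' (weylVec wt)
    rwa [he] at this
  obtain ⟨e'⟩ := nonempty_quotient_equiv_invRep e h' hrad
  exact ⟨(isHomogeneousRep_irr h').isPolynomial, (isHomogeneousRep_irr h).isPolynomial,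
    ⟨(polProp F n d).isoMk (Rep.mkIso e'.symm)⟩⟩

end TauWeyl

/-! ### The equivalence for `d ≤ n` -/

section SmallDegree

variable {F : Type*} [Field F] {n d : ℕ} {V : Type*} [AddCommGroup V] [Module F V]
  {ρ : Representation F (GL (Fin (n + 1)) F) V}

lemma diag_mul_swap (t : Fin n → Fˣ) (i j : Fin n) :
    diag t * .swap F i j = .swap F i j * diag (t ∘ Equiv.swap i j) := by
  refine Units.ext (Matrix.ext fun k l => ?_)
  change (Matrix.diagonal (fun k => (t k : F)) * (Equiv.swap i j).permMatrix F) k l =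
    ((Equiv.swap i j).permMatrix F * Matrix.diagonal fun k => (t (Equiv.swap i j k) : F)) k l
  rw [Matrix.diagonal_mul, Matrix.mul_diagonal]
  by_cases hkl : Equiv.swap i j k = l
  · simp [PEquiv.toMatrix_apply, ← hkl]
  · simp [PEquiv.toMatrix_apply, hkl]

lemma subtorus_mul_swap_last (s : Fˣ) (i : Fin (n + 1)) :
    subtorus s * .swap F i (Fin.last n) = .swap F i (Fin.last n) * diag (Pi.mulSingle i s) := by
  rw [subtorus_eq_diag_mulSingle, diag_mul_swap, Pi.mulSingle_comp_equiv, Equiv.symm_swap,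
    Equiv.swap_apply_right]

lemma swap_last_mem_invariants {μ : Fin (n + 1) → ℤ} {v : V} (hv : v ∈ weightSpace ρ μ)
    {i : Fin (n + 1)} (hi : μ i = 0) : ρ (.swap F i (Fin.last n)) v ∈ invariants ρ := by
  intro s
  rw [← Module.End.mul_apply, ← map_mul, subtorus_mul_swap_last, map_mul, Module.End.mul_apply, hv,
    ← torusChar_apply, torusChar_mulSingle, hi, zpow_zero, one_smul]

lemma exists_eq_zero_of_sum_eq {μ : Fin (n + 1) → ℤ} (hμ : ∀ i, 0 ≤ μ i) (hsum : ∑ i, μ i = d)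
    (hdn : d ≤ n) : ∃ i, μ i = 0 := by
  by_contra! h
  have hle : ((n + 1 : ℕ) : ℤ) ≤ ∑ i, μ i := by
    simpa using Finset.card_nsmul_le_sum Finset.univ μ 1 fun i _ => (hμ i).lt_of_ne' (h i)
  omega

namespace IsHomogeneousRep

variable [Infinite F] (hρ : IsHomogeneousRep d ρ) (hdn : d ≤ n)

include hρ hdn

/-- Permutation matrices move any weight vector into the truncation, as a weight of degree `d ≤ n`
has a vanishing entry. -/
theorem eq_top_of_invariants_le {W : Submodule F V} (hW : ∀ g, ∀ v ∈ W, ρ g v ∈ W)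
    (h : invariants ρ ≤ W) : W = ⊤ := by
  refine eq_top_iff.2 fun v _ => hρ.isRational.weight_induction (motive := (· ∈ W)) v
    (fun μ v hv => ?_) W.zero_mem fun _ _ => W.add_mem
  by_cases hv0 : v = 0
  · exact hv0 ▸ W.zero_mem
  obtain ⟨hμ, hsum⟩ := hρ.isPolynomial.weights μ ((Submodule.ne_bot_iff _).2 ⟨v, hv, hv0⟩)
  obtain ⟨i, hi⟩ := exists_eq_zero_of_sum_eq hμ hsum hdn
  have := hW (.swap F i (Fin.last n))⁻¹ _ (h (swap_last_mem_invariants hv hi))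
  rwa [ρ.inv_self_apply] at this

theorem eq_bot_of_disjoint_invariants {W : Submodule F V} (hW : ∀ g, ∀ v ∈ W, ρ g v ∈ W)
    (h : Disjoint W (invariants ρ)) : W = ⊥ := by
  have hσ : IsHomogeneousRep d (ρ.subrepresentation W hW) :=
    .of_jointly_injective (J := Unit) (fun _ => hρ) (f := fun _ => W.subtype) (fun _ _ _ => rfl)
      (by simp)
  have htop : (⊥ : Submodule F W) = ⊤ :=
    hσ.eq_top_of_invariants_le hdn (by simp) fun w hw =>
      Subtype.ext (Submodule.disjoint_def.1 h w w.2 fun s => congrArg Subtype.val (hw s))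
  have := (Submodule.subsingleton_iff F).1 ((subsingleton_iff_bot_eq_top).1 htop)
  exact W.eq_bot_of_subsingleton

end IsHomogeneousRep

end SmallDegree

section Equivalence

variable {F : Type u} [Field F] [Infinite F] {n d : ℕ}

theorem reflectsIsomorphisms_tau (hdn : d ≤ n) : (tau F n d).ReflectsIsomorphisms where
  reflects {M N} f hf := by
    have hbij : Function.Bijective ((underlying F n d).map ((tau F n d).map f)) :=
      ConcreteCategory.bijective_of_isIso _
    have : IsIso ((underlying F (n + 1) d).map f) := by
      refine (ConcreteCategory.isIso_iff_bijective _).2 ⟨?_, ?_⟩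
      · refine LinearMap.ker_eq_bot.1 ((isHomogeneousRep_obj M).eq_bot_of_disjoint_invariants hdn
          (W := f.hom.hom.toLinearMap.ker) (fun g v hv => ?_) (Submodule.disjoint_def.2 ?_))
        · exact (Rep.hom_comm_apply f.hom g v).trans ((congrArg _ hv).trans (map_zero _))
        · exact fun v hv hvS => congrArg Subtype.val
            (hbij.1 (a₁ := ⟨v, hvS⟩) (a₂ := 0) (Subtype.ext (hv.trans (map_zero f.hom.hom).symm)))
      · refine LinearMap.range_eq_top.1 ((isHomogeneousRep_obj N).eq_top_of_invariants_le hdn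
          (W := f.hom.hom.toLinearMap.range) ?_ fun w hw => ?_)
        · rintro g _ ⟨v, rfl⟩
          exact ⟨M.obj.ρ g v, Rep.hom_comm_apply f.hom g v⟩
        · obtain ⟨v, hv⟩ := hbij.2 ⟨w, hw⟩
          exact ⟨v.1, congrArg Subtype.val hv⟩
    exact isIso_of_reflects_iso f (underlying F (n + 1) d)

theorem isEquivalence_tau (hdn : d ≤ n) : (tau F n d).IsEquivalence := by
  let adj := tauAdjunction F n d
  have := reflectsIsomorphisms_tau (F := F) hdn
  have hcounit (N : PolRep F n d) : IsIso (adj.counit.app N) :=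
    inferInstanceAs (IsIso ((coindCounit F n d).hom.app N))
  have hunit (M : PolRep F (n + 1) d) : IsIso (adj.unit.app M) := by
    have : IsIso ((tau F n d).map (adj.unit.app M)) :=
      isIso_of_comp_hom_eq_id (adj.counit.app _) (adj.left_triangle_components M)
    exact isIso_of_reflects_iso _ (tau F n d)
  exact adj.toEquivalence.isEquivalence_functor

theorem isEquivalence_tauIter (hdn : d ≤ n) (k : ℕ) : (tauIter F n d k).IsEquivalence := by
  induction k with
  | zero => exact inferInstanceAs (𝟭 _ : PolRep F n d ⥤ PolRep F n d).IsEquivalence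
  | succ k ih =>
    have := isEquivalence_tau (F := F) (hdn.trans (Nat.le_add_right n k))
    exact inferInstanceAs (tau F (n + k) d ⋙ tauIter F n d k).IsEquivalence

end Equivalence

end PolyGL

end

theorem mainTheorem9_general (F : Type u) [Field F] [Infinite F] (n d : ℕ) :
    (PreservesFiniteLimits (PolyGL.tau F n d) ∧ PreservesFiniteColimits (PolyGL.tau F n d)) ∧
    (∀ wt : Fin n → ℤ, (∀ i, 0 ≤ wt i) → ∑ i, wt i = d →
      (∃ (h : PolyGL.polProp F (n + 1) d (PolyGL.weyl F (Fin.snoc wt 0 : Fin (n + 1) → ℤ)))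
        (h' : PolyGL.polProp F n d (PolyGL.weyl F wt)),
        Nonempty ((PolyGL.tau F n d).obj ⟨_, h⟩ ≅ ⟨_, h'⟩)) ∧
      (∃ (h : PolyGL.polProp F (n + 1) d (PolyGL.irr F (Fin.snoc wt 0 : Fin (n + 1) → ℤ)))
        (h' : PolyGL.polProp F n d (PolyGL.irr F wt)),
        Nonempty ((PolyGL.tau F n d).obj ⟨_, h⟩ ≅ ⟨_, h'⟩))) ∧
    (d ≤ n → (PolyGL.tau F n d).IsEquivalence) ∧
    (d ≤ n → ∀ k : ℕ, (PolyGL.tauIter F n d k).IsEquivalence) :=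
  ⟨⟨PolyGL.preservesFiniteLimits_tau, PolyGL.preservesFiniteColimits_tau⟩,
    fun _ hwt hd => ⟨PolyGL.tau_weyl hwt hd, PolyGL.tau_irr hwt hd⟩,
    PolyGL.isEquivalence_tau, PolyGL.isEquivalence_tauIter⟩

theorem mainTheorem9 (F : Type u) [Field F] [IsAlgClosed F] (n d : ℕ) (hn : 1 ≤ n) :
    -- `τ` is exact
    (PreservesFiniteLimits (PolyGL.tau F n d) ∧ PreservesFiniteColimits (PolyGL.tau F n d)) ∧
    -- `τ` sends `Δ(λ,0)` to `Δ(λ)` and `L(λ,0)` to `L(λ)`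
    (∀ wt : Fin n → ℤ, Antitone wt → (∀ i, 0 ≤ wt i) → ∑ i, wt i = d →
      (∃ (h : PolyGL.polProp F (n + 1) d (PolyGL.weyl F (Fin.snoc wt 0 : Fin (n + 1) → ℤ)))
        (h' : PolyGL.polProp F n d (PolyGL.weyl F wt)),
        Nonempty ((PolyGL.tau F n d).obj ⟨_, h⟩ ≅ ⟨_, h'⟩)) ∧
      (∃ (h : PolyGL.polProp F (n + 1) d (PolyGL.irr F (Fin.snoc wt 0 : Fin (n + 1) → ℤ)))
        (h' : PolyGL.polProp F n d (PolyGL.irr F wt)),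
        Nonempty ((PolyGL.tau F n d).obj ⟨_, h⟩ ≅ ⟨_, h'⟩))) ∧
    -- for `n ≥ d`, `τ` is an equivalence
    (d ≤ n → (PolyGL.tau F n d).IsEquivalence) ∧
    -- hence all `Rep^d(GL_m)` with `m ≥ d` are equivalent to the stable category `Rep^d(GL)`
    (∀ k : ℕ, (PolyGL.tauIter F (max 1 d) d k :
      PolyGL.PolRep F (max 1 d + k) d ⥤ PolyGL.StableRep F d).IsEquivalence) := by
  have := IsAlgClosed.instInfinite (K := F)
  obtain ⟨hexact, hweyl, hequiv, -⟩ := mainTheorem9_general F n d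
  exact ⟨hexact, fun wt _ => hweyl wt, hequiv,
    (mainTheorem9_general F (max 1 d) d).2.2.2 (le_max_right 1 d)⟩
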